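/- Consider the first round of the vertex colouring game on a graph $G$ with colour set $[k]=\{1,\dots,k\}$: initially no vertex is coloured; Alice and Bob alternately, Alice first, choose an uncoloured vertex and give it a colour of $[k]$ that none of its neighbours has; the round stops when no such move is left (in particular when all vertices are coloured). For a set $X_i$ of vertices and a set $Y_i\subset[k]$, we say that every colour of $Y_i$ appears in $X_i$ if for every $c\in Y_i$ some vertex of $X_i$ has colour $c$. Let $\epsilon,\eta,\gamma>0$, $l\in\mathbb N$ and $p\in(0,1)$ be fixed. For each $n$ put $k=\max(0,\lfloor (p/2-\epsilon)n\rfloor)$, let $V=\{1,\dots,n\}$ be the vertex set of the binomial random graph $G_{n,p}$, let $X_1,\dots,X_l\subset V$ be pairwise disjoint sets, chosen independently of the random graph, with $|X_i|\ge\gamma n$ for all $i$, and let $Y_1,\dots,Y_l\subset[k]$ be sets of colours (also chosen independently of the random graph) with $|Y_i|\le (1-\eta)|X_i|/2$ for all $i$. Then, with probability tending to $1$ as $n\to\infty$, Bob has a strategy in the game on $G_{n,p}$ with colour set $[k]$ which guarantees, however Alice plays, that when the first round stops, for every $i$ every colour of $Y_i$ appears in $X_i$. The convergence is uniform in the choice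 of the sets: for every $\delta>0$ there is $N=N(\epsilon,\eta,\gamma,l,p,\delta)$ such that for all $n\ge N$ and all $X_i$, $Y_i$ as above the probability is at least $1-\delta$. -/

import Mathlib

namespace ColouringGame

/-- A position of the first round: each vertex is uncoloured (`none`) or carries a colour. -/
abbrev Position (V C : Type*) := V → Option C

/-- The two players. -/
inductive Player
  | alice
  | bob

/-- Giving the vertex `v` the colour `c` is a legal move in the position `f`: the vertex is not
yet coloured, and no neighbour of it has the colour `c`. -/
def IsLegal {V C : Type*} (G : SimpleGraph V) (f : Position V C) (v : V) (c : C) : Prop :=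
  f v = none ∧ ∀ w, G.Adj v w → f w ≠ some c

/-- The position reached from `f` when the vertex `v` receives the colour `c`. -/
def move {V C : Type*} [DecidableEq V] (f : Position V C) (v : V) (c : C) : Position V C :=
  Function.update f v (some c)

/-- `BobCanEnsure G goal P f`: in the vertex colouring game on `G` with set of colours `C`, from
the position `f` with player `P` to move, Bob has a strategy such that, however Alice plays, the
position in which the round stops satisfies `goal`. The players alternate and make legal moves;
the round stops when no legal move is left, in particular when every vertex is coloured. (Which
moves are legal does not depend on the player.) -/
inductive BobCanEnsure {V C : Type*} [DecidableEq V] (G : SimpleGraph V)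
    (goal : Position V C → Prop) : Player → Position V C → Prop
  | roundOver (P : Player) (f : Position V C) (hover : ∀ v c, ¬ IsLegal G f v c) (hgoal : goal f) :
      BobCanEnsure G goal P f
  | aliceMoves (f : Position V C) (hex : ∃ v c, IsLegal G f v c)
      (h : ∀ v c, IsLegal G f v c → BobCanEnsure G goal Player.bob (move f v c)) :
      BobCanEnsure G goal Player.alice f
  | bobMoves (f : Position V C) (v : V) (c : C) (hvc : IsLegal G f v c)
      (h : BobCanEnsure G goal Player.alice (move f v c)) :
      BobCanEnsure G goal Player.bob f

/-- For every `i`, every colour of `Y i` appears on some vertex of `X i`. -/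
def AllAppear {V C ι : Type*} (X : ι → Finset V) (Y : ι → Finset C) (f : Position V C) : Prop :=
  ∀ i, ∀ c ∈ Y i, ∃ v ∈ X i, f v = some c

/-- In the first round, which starts with all vertices uncoloured and with Alice to move, Bob can
ensure that at the end every colour of each `Y i` appears in `X i`. -/
def BobCanFill {V C ι : Type*} [DecidableEq V] (G : SimpleGraph V) (X : ι → Finset V)
    (Y : ι → Finset C) : Prop :=
  BobCanEnsure G (AllAppear X Y) Player.alice (fun _ => none)

end ColouringGame

/-!
# Bob can place prescribed colours in prescribed sets

Say that `c` is pending for `i` if `c ∈ Y i` does not yet appear in `X i`. A pending colour `c` can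
be played in `X i` as long as some uncoloured vertex of `X i` has no neighbour of colour `c`. So Bob
has to keep two resources: uncoloured vertices in `X i`, and non-neighbours of colour classes among
them.

*Space.* If Bob always answers in the set `X i` in which Alice has just played, with a colour
pending there, the number of uncoloured vertices of `X i` minus twice the number of pending colours does not
decrease. It is at least `η |X i|` at the start, so Bob can afford `κ n` other moves, for a small
constant `κ`, and will still have linearly many uncoloured vertices in `X i` as long as colours are
pending for `i`. These other moves are of two kinds.

*Answers in heavy colours.* When Alice plays a pending colour that has at least `m` vertices, Bob
plays the same colour where it is pending. At most `n / m` colours ever become heavy and each is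
answered at most `l` times, so for large `m` this is affordable; and colour classes of pending
colours keep bounded size `H`.

*Dangerous vertices.* Call a set `D` of at most `H` vertices bad for `X i` if few uncoloured
vertices of `X i` have no neighbour in `D`. In the random graph, with high probability, for no linearly
large set of uncoloured vertices are there more than `T` disjoint bad sets: for fixed sets the
probability decays like `ρ ^ (T n)`, which for large `T` beats the `2 ^ n` choices of the large set
(`binomialRandom_not_expands_le`). As play goes on, Bob keeps a maximal disjoint family of bad sets
for each `i` (`IsBadFamily.exists_maximal`); bad sets stay bad, so altogether these families have a
bounded number of vertices, the dangerous ones, and every set of at most `H` other vertices is not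
bad. Bob colours the dangerous vertices as they show up, and plays their colours wherever these are
pending. This takes a bounded number of moves. Once it is done, no pending colour appears on a
dangerous vertex, nor can it in future; hence its class is not bad.

While Bob deals with dangerous vertices he leaves answers in heavy colours undone. To keep colour
classes bounded he does so at most once for each colour: an ignored colour is answered from then on
with priority over everything else. Since only boundedly many colours are ever ignored, this delays
the treatment of dangerous vertices by a bounded number of moves, during which the number of
non-neighbours drops by a bounded amount only. `Invariant` records all this, with `Ledger` as
Bob's memory, and `Invariant.exists_bob_move` is the strategy.

At the very start there may be dangerous vertices already. That they do no harm before they are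
dealt with follows from `binomialRandom_not_start_le`: with high probability every set of `H`
vertices leaves a prescribed number of non-neighbours in each `X i`.
-/

set_option linter.unusedSectionVars false

namespace ColouringGame

open Finset

section Deterministic

variable {V C ι : Type*} [DecidableEq V] [DecidableEq C]
  {G : SimpleGraph V} {X : ι → Finset V} {Y : ι → Finset C} {f : Position V C} {v : V} {c : C}

/-! ### Positions, pending colours and non-neighbours -/

/-- The uncoloured vertices of `S`. -/
def blank (f : Position V C) (S : Finset V) : Finset V := {v ∈ S | f v = none}

/-- The colours of `Y i` that do not yet appear in `X i`. -/
def pending (X : ι → Finset V) (Y : ι → Finset C) (f : Position V C) (i : ι) : Finset C :=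
  {c ∈ Y i | ∀ v ∈ X i, f v ≠ some c}

open scoped Classical in
/-- The vertices of `U` without a neighbour in `D`. -/
noncomputable def nonNeighbours (G : SimpleGraph V) (U D : Finset V) : Finset V :=
  {u ∈ U | ∀ d ∈ D, ¬ G.Adj u d}

lemma mem_blank {S : Finset V} : v ∈ blank f S ↔ v ∈ S ∧ f v = none := by simp [blank]

lemma mem_pending {i : ι} : c ∈ pending X Y f i ↔ c ∈ Y i ∧ ∀ v ∈ X i, f v ≠ some c := by
  simp [pending]

lemma mem_nonNeighbours {U D : Finset V} {u : V} :
    u ∈ nonNeighbours G U D ↔ u ∈ U ∧ ∀ d ∈ D, ¬ G.Adj u d := by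
  simp [nonNeighbours]

lemma move_self : move f v c v = some c := by simp [move]

lemma move_of_ne {w : V} (h : w ≠ v) : move f v c w = f w := by simp [move, h]

lemma move_eq_some_iff {w : V} {d : C} (hv : f v = none) :
    move f v c w = some d ↔ (w = v ∧ d = c) ∨ f w = some d := by
  by_cases h : w = v
  · subst h; simp [move_self, hv, eq_comm]
  · simp [move_of_ne h, h]

lemma move_eq_none_iff {w : V} : move f v c w = none ↔ w ≠ v ∧ f w = none := by
  by_cases h : w = v
  · subst h; simp [move_self]
  · simp [move_of_ne h, h]

lemma IsLegal.of_move {w : V} {d : C} (hv : f v = none) (h : IsLegal G (move f v c) w d) :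
    IsLegal G f w d := by
  refine ⟨(move_eq_none_iff.1 h.1).2, fun u hu hd => h.2 u hu ?_⟩
  exact (move_eq_some_iff hv).2 (.inr hd)

lemma blank_move (S : Finset V) : blank (move f v c) S = (blank f S).erase v := by
  ext w; simp only [mem_blank, mem_erase, move_eq_none_iff]; tauto

lemma nonNeighbours_empty (U : Finset V) : nonNeighbours G U ∅ = U := by
  ext; simp [mem_nonNeighbours]

lemma nonNeighbours_mono {U U' : Finset V} (h : U ⊆ U') (D : Finset V) :
    nonNeighbours G U D ⊆ nonNeighbours G U' D := fun _ hu =>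
  mem_nonNeighbours.2 ⟨h (mem_nonNeighbours.1 hu).1, (mem_nonNeighbours.1 hu).2⟩

lemma card_nonNeighbours_le_move (S D : Finset V) :
    #(nonNeighbours G (blank f S) D) ≤ #(nonNeighbours G (blank (move f v c) S) D) + 1 := by
  have : nonNeighbours G (blank (move f v c) S) D = (nonNeighbours G (blank f S) D).erase v := by
    ext u; simp only [mem_nonNeighbours, blank_move, mem_erase, and_assoc]
  rw [this]
  have := pred_card_le_card_erase (s := nonNeighbours G (blank f S) D) (a := v)
  omega

lemma card_blank_le_move (i : ι) :
    #(blank f (X i)) ≤ #(blank (move f v c) (X i)) + if v ∈ X i then 1 else 0 := by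
  rw [blank_move]
  split_ifs with h
  · have := pred_card_le_card_erase (s := blank f (X i)) (a := v)
    omega
  · rw [erase_eq_of_notMem fun hv => h (mem_blank.1 hv).1]; rfl

lemma pending_move_subset (hv : f v = none) (i : ι) :
    pending X Y (move f v c) i ⊆ pending X Y f i := by
  intro d hd
  rw [mem_pending] at hd ⊢
  exact ⟨hd.1, fun w hw h => hd.2 w hw ((move_eq_some_iff hv).2 (.inr h))⟩

lemma notMem_pending_move {i : ι} (hvi : v ∈ X i) : c ∉ pending X Y (move f v c) i := by
  rw [mem_pending]; push Not
  exact fun _ => ⟨v, hvi, move_self⟩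

lemma card_pending_move_lt {i : ι} (hv : f v = none) (hvi : v ∈ X i)
    (hc : c ∈ pending X Y f i) : #(pending X Y (move f v c) i) < #(pending X Y f i) :=
  card_lt_card ⟨pending_move_subset hv i, fun h => notMem_pending_move hvi (h hc)⟩

section Demand

variable [Fintype ι]

/-- The number of indices `i` for which the colour `c` is still pending. -/
def demand (X : ι → Finset V) (Y : ι → Finset C) (f : Position V C) (c : C) : ℕ :=
  #{i | c ∈ pending X Y f i}

lemma demand_pos : 0 < demand X Y f c ↔ ∃ i, c ∈ pending X Y f i := by
  simp [demand, card_pos, Finset.Nonempty]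

lemma demand_le : demand X Y f c ≤ Fintype.card ι := card_le_univ _

lemma demand_move_le (hv : f v = none) (d : C) :
    demand X Y (move f v c) d ≤ demand X Y f d :=
  card_le_card fun i hi => by
    rw [mem_filter] at hi ⊢; exact ⟨hi.1, pending_move_subset hv i hi.2⟩

lemma demand_move_lt {i : ι} (hv : f v = none) (hvi : v ∈ X i)
    (hc : c ∈ pending X Y f i) : demand X Y (move f v c) c < demand X Y f c := by
  refine card_lt_card ⟨fun j hj => ?_, fun h => ?_⟩
  · rw [mem_filter] at hj ⊢; exact ⟨hj.1, pending_move_subset hv j hj.2⟩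
  · have := h (mem_filter.2 ⟨mem_univ i, hc⟩)
    exact notMem_pending_move hvi (mem_filter.1 this).2

/-- The number of moves which Bob may still have to spend on the dangerous vertex `z`: colouring
`z` and then playing its colour in every `X i` that lacks it. -/
def load (X : ι → Finset V) (Y : ι → Finset C) (f : Position V C) (z : V) : ℕ :=
  match f z with
  | none => Fintype.card ι + 1
  | some c => demand X Y f c

lemma load_of_none {z : V} (h : f z = none) : load X Y f z = Fintype.card ι + 1 := by
  simp [load, h]

lemma load_of_some {z : V} (h : f z = some c) : load X Y f z = demand X Y f c := by
  simp [load, h]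

lemma load_le (z : V) : load X Y f z ≤ Fintype.card ι + 1 := by
  cases h : f z with
  | none => rw [load_of_none h]
  | some c => rw [load_of_some h]; exact demand_le.trans (Nat.le_succ _)

lemma load_move_le (hv : f v = none) (z : V) : load X Y (move f v c) z ≤ load X Y f z := by
  cases h : f z with
  | none => rw [load_of_none h]; exact load_le z
  | some d =>
    rw [load_of_some h, load_of_some ((move_eq_some_iff hv).2 (.inr h))]
    exact demand_move_le hv d

lemma load_move_lt_self (hv : f v = none) : load X Y (move f v c) v < load X Y f v := by
  rw [load_of_none hv, load_of_some move_self]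
  exact Nat.lt_succ_of_le demand_le

lemma load_move_lt_of_colour {z : V} {i : ι} (hv : f v = none) (hvi : v ∈ X i)
    (hc : c ∈ pending X Y f i) (hz : f z = some c) :
    load X Y (move f v c) z < load X Y f z := by
  rw [load_of_some hz, load_of_some ((move_eq_some_iff hv).2 (.inr hz))]
  exact demand_move_lt hv hvi hc

end Demand

section ColourClass

variable [Fintype V]

/-- The vertices of the colour `c`. -/
def colourClass (f : Position V C) (c : C) : Finset V := {v | f v = some c}

lemma mem_colourClass : v ∈ colourClass f c ↔ f v = some c := by simp [colourClass]

lemma colourClass_subset_move (hv : f v = none) (d : C) :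
    colourClass f d ⊆ colourClass (move f v c) d := fun w hw => by
  rw [mem_colourClass] at hw ⊢; exact (move_eq_some_iff hv).2 (.inr hw)

lemma card_colourClass_move_le (hv : f v = none) (d : C) :
    #(colourClass (move f v c) d) ≤ #(colourClass f d) + if d = c then 1 else 0 := by
  have : colourClass (move f v c) d ⊆
      if d = c then insert v (colourClass f d) else colourClass f d := by
    intro w hw
    rw [mem_colourClass, move_eq_some_iff hv] at hw
    split_ifs with h
    · rw [mem_insert, mem_colourClass]; tauto
    · rw [mem_colourClass]; tauto
  refine (card_le_card this).trans ?_
  split_ifs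
  · exact card_insert_le _ _
  · rfl

lemma sum_card_colourClass_le [Fintype C] : ∑ c, #(colourClass f c) ≤ Fintype.card V := by
  rw [← card_biUnion]
  · exact card_le_univ _
  · intro c _ d _ hcd
    refine disjoint_left.2 fun w hw hw' => ?_
    rw [mem_colourClass] at hw hw'
    exact hcd (Option.some_injective _ (hw.symm.trans hw'))

end ColourClass

section BadFamily

/-- A family of pairwise disjoint nonempty sets of at most `H` vertices, each of them with fewer
than `t` non-neighbours in `U`. -/
structure IsBadFamily (G : SimpleGraph V) (H t : ℕ) (U : Finset V)
    (F : Finset (Finset V)) : Prop where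
  nonempty : ∀ D ∈ F, D.Nonempty
  card_le : ∀ D ∈ F, #D ≤ H
  bad : ∀ D ∈ F, #(nonNeighbours G U D) < t
  disjoint : (F : Set (Finset V)).PairwiseDisjoint id

variable {H t : ℕ} {U : Finset V} {F : Finset (Finset V)}

lemma IsBadFamily.empty : IsBadFamily G H t U ∅ := by constructor <;> simp

lemma IsBadFamily.mono {U' : Finset V} (h : IsBadFamily G H t U F) (hU : U' ⊆ U) :
    IsBadFamily G H t U' F :=
  ⟨h.nonempty, h.card_le,
    fun D hD => (card_le_card (nonNeighbours_mono hU D)).trans_lt (h.bad D hD), h.disjoint⟩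

lemma IsBadFamily.insert {D : Finset V} (h : IsBadFamily G H t U F) (hD : D.Nonempty)
    (hH : #D ≤ H) (ht : #(nonNeighbours G U D) < t) (hF : Disjoint D (F.biUnion id)) :
    IsBadFamily G H t U (insert D F) := by
  refine ⟨?_, ?_, ?_, ?_⟩
  · simpa using ⟨hD, h.nonempty⟩
  · simpa using ⟨hH, h.card_le⟩
  · simpa using ⟨ht, h.bad⟩
  · rw [coe_insert]
    refine h.disjoint.insert fun E hE _ => ?_
    exact hF.mono_right (subset_biUnion_of_mem id hE)

/-- A bad family extends to a maximal one: then every set of at most `H` vertices that avoids all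
its members has `t` non-neighbours in `U`. -/
lemma IsBadFamily.exists_maximal [Fintype V] (h : IsBadFamily G H t U F) (htU : t ≤ #U) :
    ∃ F', F ⊆ F' ∧ IsBadFamily G H t U F' ∧
      ∀ D : Finset V, #D ≤ H → Disjoint D (F'.biUnion id) → t ≤ #(nonNeighbours G U D) := by
  obtain ⟨F', hle, hmax⟩ :=
    (Set.toFinite {F' : Finset (Finset V) | IsBadFamily G H t U F'}).exists_le_maximal h
  refine ⟨F', hle, hmax.prop, fun D hDH hDF => ?_⟩
  by_contra! hlt
  rcases D.eq_empty_or_nonempty with rfl | hD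
  · rw [nonNeighbours_empty] at hlt; omega
  have hmem : D ∈ F' := by
    have := hmax.le_of_ge (hmax.prop.insert hD hDH hlt hDF) (subset_insert D F')
    exact this (mem_insert_self D F')
  have := hDF.mono_right (subset_biUnion_of_mem id hmem)
  exact hD.ne_empty (disjoint_self.1 this)

end BadFamily

end Deterministic

section Strategy

variable {V C ι : Type*} [DecidableEq V] [DecidableEq C] [Fintype V] [Fintype C] [Fintype ι]
  {G : SimpleGraph V} {X : ι → Finset V} {Y : ι → Finset C} {f : Position V C} {v : V} {c : C}

/-! ### Bob's ledger and the invariants of his strategy -/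

/-- The numerical parameters of Bob's strategy. -/
structure Parameters where
  /-- A colour is heavy when it has at least `heavy` vertices. -/
  heavy : ℕ
  /-- The maximal size of the colour class of a pending colour. -/
  height : ℕ
  /-- The maximal size of a bad family. -/
  width : ℕ
  /-- While a colour is pending for `X i`, at least `large` vertices of `X i` are uncoloured. -/
  large : ℕ
  /-- A set with fewer than `scarce` uncoloured non-neighbours in `X i` is bad. -/
  scarce : ℕ
  /-- The number of non-neighbours in `X i` from which Bob can afford to wait. -/
  reserve : ℕ
  /-- The slack in the comparison of uncoloured vertices with pending colours. -/
  slack : ℕ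

/-- What Bob remembers of the play: bad families found so far, vertices known to be harmless, the
colours on which a move of Alice was ignored, and the numbers of his own special moves. -/
structure Ledger (V C ι : Type*) where
  /-- For each `i`, the pairwise disjoint bad sets found so far for `X i`. -/
  family : ι → Finset (Finset V)
  /-- Vertices which can no longer receive a pending colour. -/
  inert : Finset V
  /-- The colours on which Bob has left a move of Alice unanswered in order to defuse a dangerous
  vertex. -/
  ignored : Finset C
  /-- The number of answers in ignored colours. -/
  nAnswer : ℕ
  /-- The number of moves that dealt with dangerous vertices. -/
  nDefuse : ℕ
  /-- The number of answers in heavy colours that are not ignored. -/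
  nHeavy : ℕ

/-- The dangerous vertices: those of the bad sets found so far. -/
def Ledger.danger (L : Ledger V C ι) : Finset V :=
  univ.biUnion fun i => (L.family i).biUnion id

/-- The vertex `z` can no longer receive, and does not have, a pending colour. -/
def Settled (G : SimpleGraph V) (X : ι → Finset V) (Y : ι → Finset C) (f : Position V C)
    (z : V) : Prop :=
  (∀ c, f z = some c → demand X Y f c = 0) ∧ (f z = none → ∀ c, ¬ IsLegal G f z c)

/-- The heavy colours. -/
def heavyColours (m : ℕ) (f : Position V C) : Finset C := {c | m ≤ #(colourClass f c)}

/-- A pending colour `c` has few vertices: those beyond `m` are paid for, two by each index `i` for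
which `c` is no longer pending, one by an ignored move, one by a dangerous vertex, and `x c` more
are allowed for the time being. -/
def HeightBound (X : ι → Finset V) (Y : ι → Finset C) (m : ℕ) (Z : Finset V) (E : Finset C)
    (x : C → ℕ) (f : Position V C) : Prop :=
  ∀ c, 0 < demand X Y f c → #(colourClass f c) + 2 * demand X Y f c ≤
    m + 2 * Fintype.card ι + (if c ∈ E then 1 else 0) +
      (if ∃ z ∈ Z, f z = some c then 1 else 0) + x c

/-- As long as colours are pending for `X i`, the uncoloured vertices of `X i` outnumber them two
to one, with `a` to spare, up to a loss of two for each of the `N` moves with which Bob did not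
answer in the set where Alice played. -/
def SpaceBound (X : ι → Finset V) (Y : ι → Finset C) (a : ℕ) (N : ℕ)
    (y : ι → ℕ) (f : Position V C) : Prop :=
  ∀ i, (pending X Y f i).Nonempty → a + 2 * #(pending X Y f i) ≤ #(blank f (X i)) + 2 * N + y i

/-- The invariants of Bob's strategy. They are `Invariant P G X Y L 1 0 0 f` when Alice is to move.
Her move of the colour `c` at the vertex `v` creates debts, which Bob's reply has to clear: `r` is
the number of vertices coloured for which `room` has not yet been compensated, `x` is the indicator
of `c`, and `y` is the indicator of the set `X i` that contains `v`. -/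
structure Invariant (P : Parameters) (G : SimpleGraph V) (X : ι → Finset V) (Y : ι → Finset C)
    (L : Ledger V C ι) (r : ℕ) (x : C → ℕ) (y : ι → ℕ) (f : Position V C) : Prop where
  card_family : ∀ i, #(L.family i) ≤ P.width
  card_le : ∀ i, ∀ D ∈ L.family i, #D ≤ P.height
  bad : ∀ i, (pending X Y f i).Nonempty →
    IsBadFamily G P.height P.scarce (blank f (X i)) (L.family i)
  inert : ∀ z ∈ L.inert, Settled G X Y f z
  room : ∀ i, (pending X Y f i).Nonempty → ∀ D : Finset V, #D ≤ P.height → Disjoint D L.inert →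
    P.reserve ≤ #(nonNeighbours G (blank f (X i)) D) + r + 2 * (L.nAnswer + L.nDefuse)
  height : HeightBound X Y P.heavy L.danger L.ignored x f
  load : L.nDefuse + ∑ z ∈ L.danger, load X Y f z ≤ (Fintype.card ι + 1) * #L.danger
  ignored : #L.ignored ≤ L.nDefuse
  answer : L.nAnswer + ∑ c ∈ L.ignored, demand X Y f c ≤ Fintype.card ι * #L.ignored
  heavy : L.nHeavy + ∑ c ∈ heavyColours P.heavy f, demand X Y f c ≤
    Fintype.card ι * #(heavyColours P.heavy f)
  space : SpaceBound X Y (P.large + P.slack) (L.nAnswer + L.nDefuse + L.nHeavy) y f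

/-- The relations between the parameters and the graph on which the strategy rests. Here `l` is the
number of sets `X i`, `q` bounds the number of moves that defuse dangerous vertices or answer in
ignored colours, and `h` bounds the number of answers in heavy colours. -/
structure Parameters.Suitable (P : Parameters) (G : SimpleGraph V) (l q h : ℕ) : Prop where
  expands : ∀ U : Finset V, P.large ≤ #U → ∀ F, IsBadFamily G P.height P.scarce U F → #F ≤ P.width
  heavy_pos : 0 < P.heavy
  height_eq : P.height = P.heavy + 2 * l + 1
  scarce_le : P.scarce ≤ P.large
  reserve_le : P.reserve ≤ P.scarce
  le_defuse : (l + 1) ^ 2 * (l * (P.width * P.height)) ≤ q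
  lt_reserve : 2 * q + 2 < P.reserve
  le_heavy : l * Fintype.card V ≤ P.heavy * h
  slack_eq : P.slack = 2 * (q + h)

lemma Settled.step {z : V} (h : Settled G X Y f z) (hv : f v = none) (hvc : IsLegal G f v c) :
    Settled G X Y (move f v c) z := by
  have hzv : z ≠ v := by
    rintro rfl; exact h.2 hv c hvc
  refine ⟨fun d hd => ?_, fun hz d hd => h.2 (move_eq_none_iff.1 hz).2 d (hd.of_move hv)⟩
  rw [move_of_ne hzv] at hd
  exact Nat.le_zero.1 ((demand_move_le hv d).trans (h.1 d hd).le)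

lemma mem_heavyColours {m : ℕ} : c ∈ heavyColours m f ↔ m ≤ #(colourClass f c) := by
  simp [heavyColours]

lemma heavyColours_subset_move {m : ℕ} (hv : f v = none) :
    heavyColours m f ⊆ heavyColours m (move f v c) := fun d hd => by
  rw [mem_heavyColours] at hd ⊢
  exact hd.trans (card_le_card (colourClass_subset_move hv d))

lemma mul_card_heavyColours_le (m : ℕ) : m * #(heavyColours m f) ≤ Fintype.card V := by
  rw [mul_comm, ← smul_eq_mul, ← sum_const]
  calc ∑ c ∈ heavyColours m f, m ≤ ∑ c ∈ heavyColours m f, #(colourClass f c) :=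
        sum_le_sum fun c hc => mem_heavyColours.1 hc
    _ ≤ ∑ c, #(colourClass f c) := sum_le_univ_sum_of_nonneg fun _ => Nat.zero_le _
    _ ≤ _ := sum_card_colourClass_le

/-- The heavy colours can only become more numerous; the new ones bring their own allowance. -/
lemma heavy_bound_move {m n δ : ℕ} (hv : f v = none)
    (h : n + ∑ d ∈ heavyColours m f, demand X Y f d ≤ Fintype.card ι * #(heavyColours m f))
    (hδ : ∑ d ∈ heavyColours m f, demand X Y (move f v c) d + δ ≤
      ∑ d ∈ heavyColours m f, demand X Y f d) :
    n + δ + ∑ d ∈ heavyColours m (move f v c), demand X Y (move f v c) d ≤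
      Fintype.card ι * #(heavyColours m (move f v c)) := by
  have hsub := heavyColours_subset_move (m := m) (c := c) hv
  rw [← sum_sdiff hsub, ← card_sdiff_add_card_eq_card hsub, mul_add]
  have : ∑ d ∈ heavyColours m (move f v c) \ heavyColours m f, demand X Y (move f v c) d ≤
      Fintype.card ι * #(heavyColours m (move f v c) \ heavyColours m f) := by
    rw [mul_comm, ← smul_eq_mul]
    exact sum_le_card_nsmul _ _ _ fun d _ => demand_le
  omega

lemma sum_demand_move_le (hv : f v = none) (S : Finset C) :
    ∑ d ∈ S, demand X Y (move f v c) d ≤ ∑ d ∈ S, demand X Y f d :=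
  sum_le_sum fun d _ => demand_move_le hv d

lemma sum_demand_move_lt {S : Finset C} {i : ι} (hv : f v = none) (hvi : v ∈ X i)
    (hc : c ∈ pending X Y f i) (hS : c ∈ S) :
    ∑ d ∈ S, demand X Y (move f v c) d + 1 ≤ ∑ d ∈ S, demand X Y f d :=
  sum_lt_sum (fun d _ => demand_move_le hv d) ⟨c, hS, demand_move_lt hv hvi hc⟩

lemma sum_load_move_le (hv : f v = none) (Z : Finset V) :
    ∑ z ∈ Z, load X Y (move f v c) z ≤ ∑ z ∈ Z, load X Y f z :=
  sum_le_sum fun z _ => load_move_le hv z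

lemma indicator_le_move (hv : f v = none) (Z : Finset V) (d : C) :
    (if ∃ z ∈ Z, f z = some d then 1 else 0) ≤
      if ∃ z ∈ Z, move f v c z = some d then 1 else 0 := by
  split_ifs with ha hb
  · rfl
  · exact absurd (ha.imp fun z hz => ⟨hz.1, (move_eq_some_iff hv).2 (.inr hz.2)⟩) hb
  · simp
  · rfl

lemma HeightBound.step {m : ℕ} {Z : Finset V} {E : Finset C} {x : C → ℕ}
    (h : HeightBound X Y m Z E x f) (hv : f v = none) :
    HeightBound X Y m Z E (fun d => x d + if d = c then 1 else 0) (move f v c) := by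
  intro d hd
  have h1 := h d (hd.trans_le (demand_move_le hv d))
  have h2 := demand_move_le (X := X) (Y := Y) (c := c) hv d
  have h3 := card_colourClass_move_le (c := c) hv d
  have h4 := indicator_le_move (c := c) hv Z d
  simp only
  omega

/-- Playing a pending colour where it is pending lowers the left-hand side of the bound. -/
lemma HeightBound.step_pending {m : ℕ} {Z : Finset V} {E : Finset C} {x : C → ℕ} {i : ι}
    (h : HeightBound X Y m Z E x f) (hv : f v = none) (hvi : v ∈ X i)
    (hc : c ∈ pending X Y f i) :
    HeightBound X Y m Z E (fun d => x d - if d = c then 1 else 0) (move f v c) := by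
  intro d hd
  have h0 := h d (hd.trans_le (demand_move_le hv d))
  have h3 := card_colourClass_move_le (c := c) hv d
  have h4 := indicator_le_move (c := c) hv Z d
  have h2 := demand_move_le (X := X) (Y := Y) (c := c) hv d
  by_cases hdc : d = c
  · subst hdc
    have := demand_move_lt (X := X) (Y := Y) hv hvi hc
    simp only [if_true] at h3 ⊢
    omega
  · simp only [if_neg hdc] at h3 ⊢
    omega

lemma SpaceBound.step {a N : ℕ} {y : ι → ℕ} (h : SpaceBound X Y a N y f) (hv : f v = none) :
    SpaceBound X Y a N (fun i => y i + if v ∈ X i then 1 else 0) (move f v c) := by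
  intro i hi
  have h1 := h i (hi.mono (pending_move_subset hv i))
  have h2 := card_le_card (pending_move_subset (X := X) (Y := Y) (c := c) hv i)
  have h3 := card_blank_le_move (f := f) (v := v) (c := c) (X := X) i
  simp only
  omega

lemma SpaceBound.step_pending {a N : ℕ} {y : ι → ℕ} {i : ι} (h : SpaceBound X Y a N y f)
    (hX : ∀ i j, i ≠ j → Disjoint (X i) (X j)) (hv : f v = none) (hvi : v ∈ X i)
    (hc : c ∈ pending X Y f i) [DecidableEq ι] :
    SpaceBound X Y a N (fun j => y j - if j = i then 1 else 0) (move f v c) := by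
  intro j hj
  have h1 := h j (hj.mono (pending_move_subset hv j))
  have h2 := card_le_card (pending_move_subset (X := X) (Y := Y) (c := c) hv j)
  have h3 := card_blank_le_move (f := f) (v := v) (c := c) (X := X) j
  by_cases hji : j = i
  · subst hji
    have := card_pending_move_lt (X := X) (Y := Y) hv hvi hc
    simp only [if_true, if_pos hvi] at h3 ⊢
    omega
  · have : v ∉ X j := disjoint_left.1 (hX i j (Ne.symm hji)) hvi
    simp only [if_neg hji, if_neg this] at h3 ⊢
    omega

/-! ### Bounds on the number of special moves -/

variable {P : Parameters} {L : Ledger V C ι} {r q h : ℕ} {x : C → ℕ} {y : ι → ℕ}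

lemma card_danger_le (hI : Invariant P G X Y L r x y f) :
    #L.danger ≤ Fintype.card ι * (P.width * P.height) := by
  refine card_biUnion_le_card_mul _ _ _ fun i _ => ?_
  exact (card_biUnion_le_card_mul _ _ _ (hI.card_le i)).trans
    (Nat.mul_le_mul_right _ (hI.card_family i))

lemma nAnswer_add_nDefuse_le (hP : P.Suitable G (Fintype.card ι) q h)
    (hI : Invariant P G X Y L r x y f) : L.nAnswer + L.nDefuse ≤ q := by
  have h1 := card_danger_le hI
  have h2 : L.nDefuse ≤ (Fintype.card ι + 1) * #L.danger := by have := hI.load; omega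
  have h3 : L.nAnswer ≤ Fintype.card ι * L.nDefuse := by
    have := hI.answer
    have := Nat.mul_le_mul_left (Fintype.card ι) hI.ignored
    omega
  calc L.nAnswer + L.nDefuse ≤ (Fintype.card ι + 1) * L.nDefuse := by nlinarith
    _ ≤ (Fintype.card ι + 1) * ((Fintype.card ι + 1) *
          (Fintype.card ι * (P.width * P.height))) := by gcongr; exact h2.trans (by gcongr)
    _ = (Fintype.card ι + 1) ^ 2 * (Fintype.card ι * (P.width * P.height)) := by ring
    _ ≤ q := hP.le_defuse

lemma nHeavy_le (hP : P.Suitable G (Fintype.card ι) q h)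
    (hI : Invariant P G X Y L r x y f) : L.nHeavy ≤ h := by
  refine le_of_mul_le_mul_left ?_ hP.heavy_pos
  calc P.heavy * L.nHeavy ≤ P.heavy * (Fintype.card ι * #(heavyColours P.heavy f)) := by
        gcongr; have := hI.heavy; omega
    _ = Fintype.card ι * (P.heavy * #(heavyColours P.heavy f)) := by ring
    _ ≤ Fintype.card ι * Fintype.card V := by gcongr; exact mul_card_heavyColours_le _
    _ ≤ _ := hP.le_heavy

lemma large_le_card_blank (hP : P.Suitable G (Fintype.card ι) q h)
    (hI : Invariant P G X Y L r x y f) {i : ι} (hi : (pending X Y f i).Nonempty) (hy : y i ≤ 1) :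
    P.large ≤ #(blank f (X i)) := by
  have h1 := hI.space i hi
  have h2 := nAnswer_add_nDefuse_le hP hI
  have h3 := nHeavy_le hP hI
  have h4 := hP.slack_eq
  have h5 := hi.card_pos
  omega

/-- A pending colour can be played wherever it is pending. -/
lemma exists_isLegal_of_pending (hP : P.Suitable G (Fintype.card ι) q h)
    (hI : Invariant P G X Y L r x y f) (hr : r ≤ 2) (hx : x c ≤ 1) {i : ι}
    (hc : c ∈ pending X Y f i) : ∃ v ∈ X i, IsLegal G f v c := by
  have hpos : 0 < demand X Y f c := demand_pos.2 ⟨i, hc⟩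
  have hheight : #(colourClass f c) ≤ P.height := by
    have := hI.height c hpos
    rw [hP.height_eq]
    split_ifs at this <;> omega
  have hdisj : Disjoint (colourClass f c) L.inert := by
    refine disjoint_left.2 fun z hz hz' => ?_
    have := (hI.inert z hz').1 c (mem_colourClass.1 hz)
    omega
  have h1 := hI.room i ⟨c, hc⟩ _ hheight hdisj
  have h2 := nAnswer_add_nDefuse_le hP hI
  have h3 := hP.lt_reserve
  obtain ⟨v, hv⟩ : (nonNeighbours G (blank f (X i)) (colourClass f c)).Nonempty := by
    rw [← card_pos]; omega
  rw [mem_nonNeighbours, mem_blank] at hv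
  exact ⟨v, hv.1.1, hv.1.2, fun w hw hwc => hv.2 w (mem_colourClass.2 hwc) hw⟩

/-! ### Alice's moves and the search for dangerous vertices -/

lemma SpaceBound.mono {a N N' : ℕ} {y y' : ι → ℕ} (hS : SpaceBound X Y a N y f)
    (hy : ∀ i, (pending X Y f i).Nonempty → 2 * N + y i ≤ 2 * N' + y' i) :
    SpaceBound X Y a N' y' f := fun i hi => by
  have := hS i hi; have := hy i hi; omega

/-- The invariants that have nothing to do with the choice of a move survive every move. -/
lemma Invariant.step {L' : Ledger V C ι} {r' : ℕ} {x' : C → ℕ} {y' : ι → ℕ}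
    (hI : Invariant P G X Y L r x y f) (hvc : IsLegal G f v c)
    (hfam : L'.family = L.family) (hin : L'.inert = L.inert)
    (hr : r + 1 + 2 * (L.nAnswer + L.nDefuse) ≤ r' + 2 * (L'.nAnswer + L'.nDefuse))
    (h_height : HeightBound X Y P.heavy L.danger L'.ignored x' (move f v c))
    (h_load : L'.nDefuse + ∑ z ∈ L.danger, ColouringGame.load X Y (move f v c) z ≤
      L.nDefuse + ∑ z ∈ L.danger, ColouringGame.load X Y f z)
    (h_ignored : #L'.ignored ≤ L'.nDefuse)
    (h_answer : L'.nAnswer + ∑ d ∈ L'.ignored, demand X Y (move f v c) d ≤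
      Fintype.card ι * #L'.ignored)
    (h_heavy : L'.nHeavy + ∑ d ∈ heavyColours P.heavy f, demand X Y (move f v c) d ≤
      L.nHeavy + ∑ d ∈ heavyColours P.heavy f, demand X Y f d)
    (h_heavy_le : L.nHeavy ≤ L'.nHeavy)
    (h_space : SpaceBound X Y (P.large + P.slack) (L'.nAnswer + L'.nDefuse + L'.nHeavy) y'
      (move f v c)) :
    Invariant P G X Y L' r' x' y' (move f v c) := by
  have hv := hvc.1
  have hdanger : L'.danger = L.danger := by simp only [Ledger.danger, hfam]
  refine ⟨?_, ?_, ?_, ?_, ?_, ?_, ?_, h_ignored, h_answer, ?_, h_space⟩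
  · rw [hfam]; exact hI.card_family
  · rw [hfam]; exact hI.card_le
  · intro i hi
    rw [hfam]
    refine (hI.bad i (hi.mono (pending_move_subset hv i))).mono ?_
    rw [blank_move]; exact erase_subset _ _
  · rw [hin]; exact fun z hz => (hI.inert z hz).step hv hvc
  · intro i hi D hD hDd
    rw [hin] at hDd
    have h1 := hI.room i (hi.mono (pending_move_subset hv i)) D hD hDd
    have h2 := card_nonNeighbours_le_move (G := G) (f := f) (v := v) (c := c) (X i) D
    omega
  · rw [hdanger]; exact h_height
  · rw [hdanger]; exact h_load.trans hI.load
  · have := heavy_bound_move (c := c) (δ := L'.nHeavy - L.nHeavy) hv hI.heavy (by omega)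
    rwa [Nat.add_sub_cancel' h_heavy_le] at this

lemma Invariant.alice_step (hI : Invariant P G X Y L 1 0 0 f) (hvc : IsLegal G f v c) :
    Invariant P G X Y L 2 (fun d => if d = c then 1 else 0) (fun i => if v ∈ X i then 1 else 0)
      (move f v c) := by
  have hv := hvc.1
  refine hI.step hvc rfl rfl (by omega) ?_ ?_ hI.ignored ?_ ?_ le_rfl ?_
  · simpa using hI.height.step (c := c) hv
  · have := sum_load_move_le (X := X) (Y := Y) (c := c) hv L.danger; omega
  · exact (Nat.add_le_add_left (sum_demand_move_le hv _) _).trans hI.answer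
  · exact Nat.add_le_add_left (sum_demand_move_le hv _) _
  · simpa using hI.space.step (c := c) hv

lemma HeightBound.mono {m : ℕ} {Z Z' : Finset V} {E E' : Finset C} (hZ : Z ⊆ Z') (hE : E ⊆ E')
    (hH : HeightBound X Y m Z E x f) : HeightBound X Y m Z' E' x f := by
  intro d hd
  have h1 := hH d hd
  have h2 : (if d ∈ E then 1 else 0) ≤ if d ∈ E' then 1 else 0 := by
    split_ifs with ha hb
    · rfl
    · exact absurd (hE ha) hb
    · simp
    · rfl
  have h3 : (if ∃ z ∈ Z, f z = some d then 1 else 0) ≤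
      if ∃ z ∈ Z', f z = some d then 1 else 0 := by
    split_ifs with ha hb
    · rfl
    · exact absurd (ha.imp fun z hz => ⟨hZ hz.1, hz.2⟩) hb
    · simp
    · rfl
  omega

/-- Bob extends the bad families to maximal ones. If then no dangerous vertex is left to deal with,
every set that avoids them has many non-neighbours, and the debt `r` is cancelled. -/
lemma Invariant.search (hP : P.Suitable G (Fintype.card ι) q h)
    (hI : Invariant P G X Y L 2 x y f) (hy : ∀ i, y i ≤ 1) :
    ∃ L' r, Invariant P G X Y L' r x y f ∧
      (r = 0 ∨ r = 2 ∧ ∃ z ∈ L'.danger, ¬ Settled G X Y f z) := by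
  have key : ∀ i, ∃ F, L.family i ⊆ F ∧ #F ≤ P.width ∧ (∀ D ∈ F, #D ≤ P.height) ∧
      ((pending X Y f i).Nonempty → IsBadFamily G P.height P.scarce (blank f (X i)) F ∧
        ∀ D : Finset V, #D ≤ P.height → Disjoint D (F.biUnion id) →
          P.scarce ≤ #(nonNeighbours G (blank f (X i)) D)) := by
    intro i
    -- Once no colour is pending for `i`, the set `X i` may run out of uncoloured vertices, and
    -- its family is left as it is.
    by_cases hi : (pending X Y f i).Nonempty
    · have hl := large_le_card_blank hP hI hi (hy i)
      obtain ⟨F, hsub, hF, hmax⟩ := (hI.bad i hi).exists_maximal (hP.scarce_le.trans hl)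
      exact ⟨F, hsub, hP.expands _ hl F hF, hF.card_le, fun _ => ⟨hF, hmax⟩⟩
    · exact ⟨L.family i, Subset.rfl, hI.card_family i, hI.card_le i, fun h => absurd h hi⟩
  choose F hsub hcard hle hF using key
  have hdanger : L.danger ⊆ univ.biUnion fun i => (F i).biUnion id :=
    biUnion_mono fun i _ => biUnion_subset_biUnion_of_subset_left _ (hsub i)
  set Z : Finset V := univ.biUnion fun i => (F i).biUnion id with hZ
  have hload : L.nDefuse + ∑ z ∈ Z, ColouringGame.load X Y f z ≤ (Fintype.card ι + 1) * #Z := by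
    rw [← sum_sdiff hdanger, ← card_sdiff_add_card_eq_card hdanger, mul_add]
    have h1 : ∑ z ∈ Z \ L.danger, ColouringGame.load X Y f z ≤
        (Fintype.card ι + 1) * #(Z \ L.danger) := by
      rw [mul_comm, ← smul_eq_mul]
      exact sum_le_card_nsmul _ _ _ fun z _ => load_le z
    have := hI.load
    omega
  by_cases hset : ∀ z ∈ Z, Settled G X Y f z
  · refine ⟨{ L with family := F, inert := Z }, 0, ⟨hcard, hle, fun i hi => (hF i hi).1, hset, ?_,
      hI.height.mono hdanger Subset.rfl, hload, hI.ignored, hI.answer, hI.heavy, hI.space⟩,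
      .inl rfl⟩
    intro i hi D hD hDd
    have h1 := (hF i hi).2 D hD (hDd.mono_right
      (subset_biUnion_of_mem (fun i => (F i).biUnion id) (mem_univ i)))
    have := hP.reserve_le
    omega
  · refine ⟨{ L with family := F }, 2, ⟨hcard, hle, fun i hi => (hF i hi).1, hI.inert, hI.room,
      hI.height.mono hdanger Subset.rfl, hload, hI.ignored, hI.answer, hI.heavy, hI.space⟩,
      .inr ⟨rfl, ?_⟩⟩
    push Not at hset
    exact hset

/-! ### Bob's moves -/

/-- Ignoring the last move of Alice, in the colour `c`, is paid for by adding `c` to the ignored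
colours. -/
lemma HeightBound.insert_ignored {m : ℕ} {Z : Finset V} {E : Finset C}
    (hH : HeightBound X Y m Z E (fun d => if d = c then 1 else 0) f)
    (hc : ¬ (c ∈ E ∧ 0 < demand X Y f c)) : HeightBound X Y m Z (insert c E) 0 f := by
  intro d hd
  have h1 := hH d hd
  by_cases hdc : d = c
  · subst hdc
    have : d ∉ E := fun h => hc ⟨h, hd⟩
    simp only [mem_insert_self, if_true, if_neg this, Pi.zero_apply] at h1 ⊢
    omega
  · simpa [mem_insert, hdc] using h1

/-- A colour with few vertices needs no answer. -/
lemma HeightBound.of_light {m : ℕ} {Z : Finset V} {E : Finset C}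
    (hH : HeightBound X Y m Z E (fun d => if d = c then 1 else 0) f)
    (hc : ¬ (c ∈ heavyColours m f ∧ 0 < demand X Y f c)) : HeightBound X Y m Z E 0 f := by
  intro d hd
  have h1 := hH d hd
  by_cases hdc : d = c
  · subst hdc
    have h2 : ¬ m ≤ #(colourClass f d) := fun h => hc ⟨mem_heavyColours.2 h, hd⟩
    have h3 : demand X Y f d ≤ Fintype.card ι := demand_le
    simp only [Pi.zero_apply]
    omega
  · simpa [hdc] using h1

lemma sum_demand_insert_le (E : Finset C) (hv : f v = none) (d : C) {n : ℕ}
    (hE : n + ∑ d ∈ E, demand X Y f d ≤ Fintype.card ι * #E) :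
    n + ∑ e ∈ insert c E, demand X Y (move f v d) e ≤ Fintype.card ι * #(insert c E) := by
  have h1 := sum_demand_move_le (X := X) (Y := Y) (c := d) hv E
  by_cases hc : c ∈ E
  · rw [insert_eq_of_mem hc]; omega
  · rw [sum_insert hc, card_insert_of_notMem hc, mul_add, mul_one]
    have : demand X Y (move f v d) c ≤ Fintype.card ι := demand_le
    omega

/-- Bob answers Alice's move in an ignored colour `c` by playing `c` where it is pending. -/
lemma Invariant.answer_step
    (hI : Invariant P G X Y L r (fun d => if d = c then 1 else 0)
      (fun i => if v ∈ X i then 1 else 0) f) (hr : r ≤ 2) (hcE : c ∈ L.ignored) {i : ι} {w : V}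
    (hw : IsLegal G f w c) (hwi : w ∈ X i) (hc : c ∈ pending X Y f i) :
    Invariant P G X Y { L with nAnswer := L.nAnswer + 1 } 1 0 0 (move f w c) := by
  have hw0 := hw.1
  refine hI.step hw rfl rfl (by simp only; omega) ?_ ?_ hI.ignored ?_ ?_ le_rfl ?_
  · have := hI.height.step_pending hw0 hwi hc
    simp only [tsub_self] at this
    exact this
  · have := sum_load_move_le (X := X) (Y := Y) (c := c) hw0 L.danger
    simp only; omega
  · have := sum_demand_move_lt hw0 hwi hc hcE
    have := hI.answer
    simp only; omega
  · exact Nat.add_le_add_left (sum_demand_move_le hw0 _) _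
  · refine (hI.space.step (c := c) hw0).mono fun j _ => ?_
    simp only [Pi.zero_apply]; split_ifs <;> omega

/-- Bob answers Alice's move in a heavy colour `c` by playing `c` where it is pending. -/
lemma Invariant.heavy_step
    (hI : Invariant P G X Y L 0 (fun d => if d = c then 1 else 0)
      (fun i => if v ∈ X i then 1 else 0) f) (hch : c ∈ heavyColours P.heavy f) {i : ι} {w : V}
    (hw : IsLegal G f w c) (hwi : w ∈ X i) (hc : c ∈ pending X Y f i) :
    Invariant P G X Y { L with nHeavy := L.nHeavy + 1 } 1 0 0 (move f w c) := by
  have hw0 := hw.1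
  refine hI.step hw rfl rfl (by simp only; omega) ?_ ?_ hI.ignored ?_ ?_ (Nat.le_succ _) ?_
  · have := hI.height.step_pending hw0 hwi hc
    simp only [tsub_self] at this
    exact this
  · have := sum_load_move_le (X := X) (Y := Y) (c := c) hw0 L.danger
    simp only; omega
  · exact (Nat.add_le_add_left (sum_demand_move_le hw0 _) _).trans hI.answer
  · have := sum_demand_move_lt hw0 hwi hc hch
    simp only; omega
  · refine (hI.space.step (c := c) hw0).mono fun j _ => ?_
    simp only [Pi.zero_apply]; split_ifs <;> omega

/-- Bob ignores Alice's move in the colour `c`, and plays the colour `d` of a dangerous vertex where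
it is pending. -/
lemma Invariant.defuse_colour_step
    (hI : Invariant P G X Y L r (fun d => if d = c then 1 else 0)
      (fun i => if v ∈ X i then 1 else 0) f) (hr : r ≤ 2)
    (hcE : ¬ (c ∈ L.ignored ∧ 0 < demand X Y f c)) {z : V} {d : C} (hz : z ∈ L.danger)
    (hzd : f z = some d) {i : ι} {w : V}
    (hw : IsLegal G f w d) (hwi : w ∈ X i) (hd : d ∈ pending X Y f i) :
    Invariant P G X Y { L with ignored := insert c L.ignored, nDefuse := L.nDefuse + 1 } 1 0 0
      (move f w d) := by
  have hw0 := hw.1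
  refine hI.step hw rfl rfl (by simp only; omega) ?_ ?_ ?_ ?_ ?_ le_rfl ?_
  · have := (hI.height.insert_ignored hcE).step_pending hw0 hwi hd
    simp only [Pi.zero_apply, zero_tsub] at this
    exact this
  · have : ∑ z ∈ L.danger, ColouringGame.load X Y (move f w d) z <
        ∑ z ∈ L.danger, ColouringGame.load X Y f z :=
      sum_lt_sum (fun z _ => load_move_le hw0 z) ⟨z, hz, load_move_lt_of_colour hw0 hwi hd hzd⟩
    simp only; omega
  · exact (card_insert_le _ _).trans (Nat.succ_le_succ hI.ignored)
  · exact sum_demand_insert_le _ hw0 d hI.answer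
  · exact Nat.add_le_add_left (sum_demand_move_le hw0 _) _
  · refine (hI.space.step (c := d) hw0).mono fun j _ => ?_
    simp only [Pi.zero_apply]; split_ifs <;> omega

/-- Bob ignores Alice's move in the colour `c`, and colours a dangerous vertex `z`, at a moment when
no dangerous vertex has a pending colour. -/
lemma Invariant.defuse_vertex_step
    (hI : Invariant P G X Y L r (fun d => if d = c then 1 else 0)
      (fun i => if v ∈ X i then 1 else 0) f) (hr : r ≤ 2)
    (hcE : ¬ (c ∈ L.ignored ∧ 0 < demand X Y f c)) {z : V} {d : C} (hz : z ∈ L.danger)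
    (hcol : ∀ z ∈ L.danger, ∀ e, f z = some e → demand X Y f e = 0) (hzd : IsLegal G f z d) :
    Invariant P G X Y { L with ignored := insert c L.ignored, nDefuse := L.nDefuse + 1 } 1 0 0
      (move f z d) := by
  have hz0 := hzd.1
  refine hI.step hzd rfl rfl (by simp only; omega) ?_ ?_ ?_ ?_ ?_ le_rfl ?_
  · have hH := hI.height.insert_ignored hcE
    intro e he
    have he' : 0 < demand X Y f e := he.trans_le (demand_move_le hz0 e)
    have h1 := hH.step (c := d) hz0 e he
    by_cases hed : e = d
    -- The vertex `z` itself makes its new colour `d` dangerous, which pays for the move.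
    · subst hed
      have h2 := hH e he'
      have h3 : ¬ ∃ z ∈ L.danger, f z = some e := fun ⟨z', hz', h⟩ => by
        have := hcol z' hz' e h; omega
      have h4 : ∃ z' ∈ L.danger, move f z e z' = some e := ⟨z, hz, move_self⟩
      have h5 := card_colourClass_move_le (c := e) hz0 e
      have h6 := demand_move_le (X := X) (Y := Y) (c := e) hz0 e
      simp only [if_neg h3, if_pos h4, if_true, Pi.zero_apply] at h2 h5 ⊢
      omega
    · simpa only [Pi.zero_apply, if_neg hed, add_zero] using h1
  · have : ∑ z' ∈ L.danger, ColouringGame.load X Y (move f z d) z' <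
        ∑ z' ∈ L.danger, ColouringGame.load X Y f z' :=
      sum_lt_sum (fun z' _ => load_move_le hz0 z') ⟨z, hz, load_move_lt_self hz0⟩
    simp only; omega
  · exact (card_insert_le _ _).trans (Nat.succ_le_succ hI.ignored)
  · exact sum_demand_insert_le _ hz0 d hI.answer
  · exact Nat.add_le_add_left (sum_demand_move_le hz0 _) _
  · refine (hI.space.step (c := d) hz0).mono fun j _ => ?_
    simp only [Pi.zero_apply]; split_ifs <;> omega

/-- Bob answers in the set in which Alice has played, if colours are pending there. -/
lemma Invariant.pair_step (hX : ∀ i j, i ≠ j → Disjoint (X i) (X j))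
    (hI : Invariant P G X Y L 0 (fun d => if d = c then 1 else 0)
      (fun i => if v ∈ X i then 1 else 0) f)
    (hch : ¬ (c ∈ heavyColours P.heavy f ∧ 0 < demand X Y f c)) {i : ι} {w : V} {d : C}
    (hi : ∀ j, j ≠ i → v ∈ X j → ¬ (pending X Y f j).Nonempty)
    (hw : IsLegal G f w d) (hwi : w ∈ X i) (hd : d ∈ pending X Y f i) :
    Invariant P G X Y L 1 0 0 (move f w d) := by
  classical
  have hw0 := hw.1
  refine hI.step hw rfl rfl (by omega) ?_ ?_ hI.ignored ?_ ?_ le_rfl ?_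
  · have := (hI.height.of_light hch).step_pending hw0 hwi hd
    simp only [Pi.zero_apply, zero_tsub] at this
    exact this
  · have := sum_load_move_le (X := X) (Y := Y) (c := d) hw0 L.danger
    omega
  · exact (Nat.add_le_add_left (sum_demand_move_le hw0 _) _).trans hI.answer
  · exact Nat.add_le_add_left (sum_demand_move_le hw0 _) _
  · refine (hI.space.step_pending hX hw0 hwi hd).mono fun j hj => ?_
    have hj' := hj.mono (pending_move_subset hw0 j)
    by_cases hji : j = i
    · simp only [hji, Pi.zero_apply, if_true]; split_ifs <;> omega
    · have : v ∉ X j := fun hv => hi j hji hv hj'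
      simp only [if_neg this, if_neg hji, Pi.zero_apply]; omega

/-- After every move of Alice, Bob has a move that restores the invariants. -/
lemma Invariant.exists_bob_move (hX : ∀ i j, i ≠ j → Disjoint (X i) (X j))
    (hP : P.Suitable G (Fintype.card ι) q h)
    (hI : Invariant P G X Y L 2 (fun d => if d = c then 1 else 0)
      (fun i => if v ∈ X i then 1 else 0) f) (hpend : ∃ i, (pending X Y f i).Nonempty) :
    ∃ w d L', IsLegal G f w d ∧ Invariant P G X Y L' 1 0 0 (move f w d) := by
  obtain ⟨L, r, hI, hr⟩ := hI.search hP (fun i => by split_ifs <;> omega)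
  have hr2 : r ≤ 2 := by omega
  have hx : ∀ d, (if d = c then 1 else 0) ≤ 1 := fun d => by split_ifs <;> omega
  by_cases hA : c ∈ L.ignored ∧ 0 < demand X Y f c
  -- An ignored colour is answered before anything else.
  · obtain ⟨i, hi⟩ := demand_pos.1 hA.2
    obtain ⟨w, hwi, hw⟩ := exists_isLegal_of_pending hP hI hr2 (hx c) hi
    exact ⟨w, c, _, hw, hI.answer_step hr2 hA.1 hw hwi hi⟩
  rcases hr with rfl | ⟨-, z, hz, hset⟩
  · by_cases hC : c ∈ heavyColours P.heavy f ∧ 0 < demand X Y f c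
    · obtain ⟨i, hi⟩ := demand_pos.1 hC.2
      obtain ⟨w, hwi, hw⟩ := exists_isLegal_of_pending hP hI hr2 (hx c) hi
      exact ⟨w, c, _, hw, hI.heavy_step hC.1 hw hwi hi⟩
    · obtain ⟨i, ⟨d, hd⟩, hi⟩ : ∃ i, (pending X Y f i).Nonempty ∧
          ∀ j, j ≠ i → v ∈ X j → ¬ (pending X Y f j).Nonempty := by
        by_cases hv : ∃ i, v ∈ X i ∧ (pending X Y f i).Nonempty
        · obtain ⟨i, hvi, hi⟩ := hv
          exact ⟨i, hi, fun j hji hvj => absurd hvi (disjoint_left.1 (hX j i hji) hvj)⟩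
        · obtain ⟨i, hi⟩ := hpend
          exact ⟨i, hi, fun j _ hvj hj => hv ⟨j, hvj, hj⟩⟩
      obtain ⟨w, hwi, hw⟩ := exists_isLegal_of_pending hP hI hr2 (hx d) hd
      exact ⟨w, d, _, hw, hI.pair_step hX hC hi hw hwi hd⟩
  -- The colours of dangerous vertices are dealt with before uncoloured dangerous vertices, so that
  -- no colour is used twice on dangerous vertices by Bob while it is pending.
  · by_cases hcol : ∀ z ∈ L.danger, ∀ e, f z = some e → demand X Y f e = 0
    · have : ∃ d, IsLegal G f z d := by
        by_contra! hno
        exact hset ⟨hcol z hz, fun _ => hno⟩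
      obtain ⟨d, hd⟩ := this
      exact ⟨z, d, _, hd, hI.defuse_vertex_step hr2 hA hz hcol hd⟩
    · push Not at hcol
      obtain ⟨z', hz', e, he, hdem⟩ := hcol
      obtain ⟨i, hi⟩ := demand_pos.1 (Nat.pos_of_ne_zero hdem)
      obtain ⟨w, hwi, hw⟩ := exists_isLegal_of_pending hP hI hr2 (hx e) hi
      exact ⟨w, e, _, hw, hI.defuse_colour_step hr2 hA hz' he hw hwi hi⟩

/-! ### The strategy wins -/

lemma AllAppear.of_pending_eq_empty (hf : ∀ i, ¬ (pending X Y f i).Nonempty) :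
    AllAppear X Y f := by
  intro i c hc
  by_contra! hno
  exact hf i ⟨c, mem_pending.2 ⟨hc, hno⟩⟩

lemma card_blank_move_lt (hv : f v = none) : #(blank (move f v c) univ) < #(blank f univ) := by
  rw [blank_move]
  exact card_erase_lt_of_mem (mem_blank.2 ⟨mem_univ v, hv⟩)

/-- Once every colour of each `Y i` appears in `X i`, the rest of the round is irrelevant. -/
lemma bobCanEnsure_of_allAppear (Q : Player) (hf : AllAppear X Y f) :
    BobCanEnsure G (AllAppear X Y) Q f := by
  induction hn : #(blank f univ) using Nat.strong_induction_on generalizing f Q with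
  | _ n ih =>
    have next : ∀ Q v c, IsLegal G f v c → BobCanEnsure G (AllAppear X Y) Q (move f v c) := by
      intro Q v c hvc
      refine ih _ (hn ▸ card_blank_move_lt hvc.1) Q (fun i d hd => ?_) rfl
      obtain ⟨w, hw, hwd⟩ := hf i d hd
      exact ⟨w, hw, (move_eq_some_iff hvc.1).2 (.inr hwd)⟩
    by_cases hex : ∃ v c, IsLegal G f v c
    · cases Q with
      | alice => exact .aliceMoves f hex (next _)
      | bob => obtain ⟨v, c, hvc⟩ := hex; exact .bobMoves f v c hvc (next _ v c hvc)
    · push Not at hex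
      exact .roundOver Q f hex hf

lemma Invariant.bobCanEnsure (hX : ∀ i j, i ≠ j → Disjoint (X i) (X j))
    (hP : P.Suitable G (Fintype.card ι) q h) (hI : Invariant P G X Y L 1 0 0 f) :
    BobCanEnsure G (AllAppear X Y) Player.alice f := by
  induction hn : #(blank f univ) using Nat.strong_induction_on generalizing f L with
  | _ n ih =>
    by_cases hpend : ∃ i, (pending X Y f i).Nonempty
    · have hex : ∃ v c, IsLegal G f v c := by
        obtain ⟨i, c, hc⟩ := hpend
        obtain ⟨v, -, hv⟩ := exists_isLegal_of_pending hP hI (by omega) (Nat.zero_le _) hc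
        exact ⟨v, c, hv⟩
      refine .aliceMoves f hex fun v c hvc => ?_
      by_cases hpend' : ∃ i, (pending X Y (move f v c) i).Nonempty
      · obtain ⟨w, d, L', hwd, hI'⟩ := (hI.alice_step hvc).exists_bob_move hX hP hpend'
        exact .bobMoves _ w d hwd <|
          ih _ (hn ▸ (card_blank_move_lt hwd.1).trans (card_blank_move_lt hvc.1)) hI' rfl
      · push Not at hpend'
        exact bobCanEnsure_of_allAppear _ (.of_pending_eq_empty (by simpa using hpend'))
    · push Not at hpend
      exact bobCanEnsure_of_allAppear _ (.of_pending_eq_empty (by simpa using hpend))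

/-- Bob wins on every graph in which bad families are small and, at the start, no set of at most
`P.height` vertices is bad. -/
theorem bobCanFill_of_suitable (hX : ∀ i j, i ≠ j → Disjoint (X i) (X j))
    (hP : P.Suitable G (Fintype.card ι) q h)
    (hstart : ∀ i, ∀ D : Finset V, #D ≤ P.height → P.reserve ≤ #(nonNeighbours G (X i) D))
    (hspace : ∀ i, P.large + P.slack + 2 * #(Y i) ≤ #(X i)) : BobCanFill G X Y := by
  have hblank : ∀ S : Finset V, blank (fun _ => none : Position V C) S = S := fun S => by
    ext; simp [mem_blank]
  have hclass : ∀ c, colourClass (fun _ => none : Position V C) c = ∅ := fun c => by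
    ext; simp [mem_colourClass]
  refine Invariant.bobCanEnsure (P := P) (L := ⟨fun _ => ∅, ∅, ∅, 0, 0, 0⟩) hX hP
    ⟨by simp, by simp, fun i _ => .empty, by simp, ?_, ?_, ?_, by simp, by simp, ?_, ?_⟩
  · intro i _ D hD _
    rw [hblank]
    exact (hstart i D hD).trans (by omega)
  · intro c _
    have : demand X Y (fun _ => none) c ≤ Fintype.card ι := demand_le
    rw [hclass, card_empty]
    omega
  · have : (univ.biUnion fun _ : ι => (∅ : Finset V)) = ∅ := by ext; simp
    simp [Ledger.danger, this]
  · have : heavyColours P.heavy (fun _ => none : Position V C) = ∅ := by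
      ext c
      have := hP.heavy_pos
      rw [mem_heavyColours, hclass, card_empty]
      simp; omega
    simp [this]
  · intro i _
    have : #(pending X Y (fun _ => none) i) ≤ #(Y i) := 
      card_le_card fun c hc => (mem_pending.1 hc).1
    have := hspace i
    rw [hblank]
    omega

end Strategy

open MeasureTheory ProbabilityTheory

/-! ### Independent edges -/

section Independence

variable {I J : Type*} [Fintype I] [DecidableEq I]

/-- For disjoint blocks of at most `H` independent events of probability at most `1 - a`, the
probability that every block contains an event that occurs is at most `(1 - a ^ H) ^ b`, where `b`
is the number of blocks. -/
lemma infinitePi_forall_exists_le (ν : I → Measure Prop) [∀ e, IsProbabilityMeasure (ν e)]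
    {a : ℝ} (ha0 : 0 ≤ a) (ha1 : a ≤ 1) {H : ℕ} (S : Finset J) (B : J → Finset I)
    (hB : (S : Set J).PairwiseDisjoint B) (hH : ∀ j ∈ S, #(B j) ≤ H)
    (ha : ∀ j ∈ S, ∀ e ∈ B j, a ≤ (ν e).real {False}) :
    (Measure.infinitePi ν).real {ω | ∀ j ∈ S, ∃ e ∈ B j, ω e} ≤ (1 - a ^ H) ^ #S := by
  classical
  induction S using Finset.induction_on with
  | empty => simp
  | insert j S hj ih =>
    rw [coe_insert, Set.pairwiseDisjoint_insert_of_notMem (by simpa using hj)] at hB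
    have hind : iIndepFun (fun e (ω : I → Prop) => ω e) (Measure.infinitePi ν) :=
      iIndepFun_infinitePi (X := fun _ P => P) (fun _ => measurable_id)
    have hdisj : Disjoint (B j) (S.biUnion B) := by
      rw [disjoint_biUnion_right]; exact hB.2
    have hprod := (hind.indepFun_finset (B j) (S.biUnion B) hdisj
      (fun e => measurable_pi_apply e)).measure_inter_preimage_eq_mul
        {g | ∃ e, g e} {g | ∀ i (hi : i ∈ S), ∃ e, ∃ he : e ∈ B i,
          g ⟨e, mem_biUnion.2 ⟨i, hi, he⟩⟩} .of_discrete .of_discrete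
    have hleft : (fun (ω : I → Prop) (e : B j) => ω e) ⁻¹' {g | ∃ e, g e} =
        {ω | ∃ e ∈ B j, ω e} := by ext ω; simp
    have hright : (fun (ω : I → Prop) (e : S.biUnion B) => ω e) ⁻¹'
        {g | ∀ i (hi : i ∈ S), ∃ e, ∃ he : e ∈ B i, g ⟨e, mem_biUnion.2 ⟨i, hi, he⟩⟩} =
        {ω | ∀ i ∈ S, ∃ e ∈ B i, ω e} := by ext ω; simp
    rw [hleft, hright] at hprod
    have hinter : {ω : I → Prop | ∀ i ∈ insert j S, ∃ e ∈ B i, ω e} =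
        {ω | ∃ e ∈ B j, ω e} ∩ {ω | ∀ i ∈ S, ∃ e ∈ B i, ω e} := by
      ext ω; simp
    have hone : (Measure.infinitePi ν).real {ω | ∃ e ∈ B j, ω e} ≤ 1 - a ^ H := by
      have hcompl : {ω : I → Prop | ∃ e ∈ B j, ω e} = ((B j : Set I).pi fun _ => {False})ᶜ := by
        ext ω; simp [Set.mem_pi]
      rw [hcompl, measureReal_compl .of_discrete, probReal_univ, measureReal_def,
        Measure.infinitePi_pi ν (fun _ _ => .of_discrete), ENNReal.toReal_prod]
      gcongr
      calc a ^ H ≤ a ^ #(B j) := pow_le_pow_of_le_one ha0 ha1 (hH j (mem_insert_self j S))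
        _ = ∏ e ∈ B j, a := (prod_const a).symm
        _ ≤ ∏ e ∈ B j, (ν e {False}).toReal :=
            prod_le_prod (fun _ _ => ha0) fun e he => ha j (mem_insert_self j S) e he
    rw [hinter, measureReal_def, hprod, ENNReal.toReal_mul, card_insert_of_notMem hj, pow_succ,
      mul_comm]
    refine mul_le_mul ?_ hone measureReal_nonneg
      (pow_nonneg (sub_nonneg.2 (pow_le_one₀ ha0 ha1)) _)
    exact ih hB.1 (fun i hi => hH i (mem_insert_of_mem hi))
      fun i hi => ha i (mem_insert_of_mem hi)

end Independence

section RandomGraph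

variable {V : Type*} [Fintype V] [DecidableEq V]

/-- All vertices of `U` have a neighbour in each of `T` disjoint sets `D j` with probability at most
`ρ ^ (T * (#U - T * H))`, where `ρ = 1 - (1 - p) ^ H`. The at most `T * H` vertices of `U` in some
`D j` are discarded: for the others, the edges to the sets `D j` are all distinct. -/
lemma binomialRandom_forall_exists_adj_le (p : unitInterval) {T H : ℕ} (U : Finset V)
    (D : Fin T → Finset V) (hD : ∀ i j, i ≠ j → Disjoint (D i) (D j)) (hH : ∀ j, #(D j) ≤ H) :
    (SimpleGraph.binomialRandom V p).real {G | ∀ u ∈ U, ∀ j, ∃ d ∈ D j, G.Adj u d} ≤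
      (1 - (1 - (p : ℝ)) ^ H) ^ (T * (#U - T * H)) := by
  classical
  set U₀ := U \ univ.biUnion D with hU₀
  have hcard : #U - T * H ≤ #U₀ := by
    have h1 : #(univ.biUnion D) ≤ T * H := by
      simpa using card_biUnion_le_card_mul univ D H fun j _ => hH j
    have h2 := le_card_sdiff (univ.biUnion D) U
    rw [hU₀]
    omega
  have hnot : ∀ u ∈ U₀, ∀ j, u ∉ D j := fun u hu j huj =>
    (mem_sdiff.1 hu).2 (mem_biUnion.2 ⟨j, mem_univ j, huj⟩)
  have hp0 : (0 : ℝ) ≤ 1 - p := sub_nonneg.2 p.2.2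
  have hp1 : 1 - (p : ℝ) ≤ 1 := sub_le_self _ p.2.1
  set B : V × Fin T → Finset (Sym2 V) := fun x => (D x.2).image fun d => s(x.1, d) with hB
  set ν : Sym2 V → Measure Prop := fun e =>
    unitInterval.toNNReal p • Measure.dirac (e ∈ (Sym2.diagSet : Set (Sym2 V))ᶜ) +
      unitInterval.toNNReal (unitInterval.symm p) • Measure.dirac False with hν
  have hprob : ∀ e, IsProbabilityMeasure (ν e) := fun e => by rw [hν]; infer_instance
  have hmeas : MeasurableSet {G : SimpleGraph V | ∀ u ∈ U, ∀ j, ∃ d ∈ D j, G.Adj u d} := by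
    measurability
  rw [SimpleGraph.binomialRandom_eq_map, setBernoulli_eq_map, measureReal_def,
    Measure.map_apply SimpleGraph.measurable_fromEdgeSet hmeas,
    Measure.map_apply (by fun_prop) (SimpleGraph.measurable_fromEdgeSet hmeas), ← measureReal_def]
  have hbound := infinitePi_forall_exists_le ν hp0 hp1 (H := H) (U₀ ×ˢ univ) B ?_ ?_ ?_
  · refine (measureReal_mono ?_).trans (hbound.trans ?_)
    · intro ω hω x hx
      obtain ⟨d, hd, hadj⟩ := hω x.1 (mem_sdiff.1 (mem_product.1 hx).1).1 x.2
      exact ⟨s(x.1, d), mem_image_of_mem _ hd, (SimpleGraph.fromEdgeSet_adj _).1 hadj |>.1⟩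
    · refine pow_le_pow_of_le_one (sub_nonneg.2 (pow_le_one₀ hp0 hp1))
        (sub_le_self _ (pow_nonneg hp0 _)) ?_
      rw [card_product, card_univ, Fintype.card_fin, mul_comm]
      exact Nat.mul_le_mul_right _ hcard
  · rintro ⟨u, i⟩ hu ⟨w, j⟩ hw hne
    refine disjoint_left.2 fun e he he' => ?_
    obtain ⟨d, hd, rfl⟩ := mem_image.1 he
    obtain ⟨d', hd', heq⟩ := mem_image.1 he'
    simp only [coe_product, coe_univ, Set.mem_prod, mem_coe] at hu hw hd hd' heq
    rcases Sym2.eq_iff.1 heq with ⟨rfl, rfl⟩ | ⟨rfl, rfl⟩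
    · have hij : i ≠ j := fun h => hne (by rw [h])
      exact disjoint_left.1 (hD i j hij) hd hd'
    · exact hnot _ hu.1 j hd'
  · exact fun x _ => card_image_le.trans (hH x.2)
  · rintro ⟨u, j⟩ hu e he
    obtain ⟨d, hd, rfl⟩ := mem_image.1 he
    have hud : u ≠ d := by
      rintro rfl
      exact hnot u (mem_product.1 hu).1 j hd
    simp [hν, measureReal_def, hud]

/-- The union bound over all sets `U` of a family `𝒰` and all choices of `T` disjoint sets of at
most `H` vertices, each given as the range of a function on `Fin H`. -/
lemma binomialRandom_exists_dominating_le (p : unitInterval) {T H a : ℕ}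
    (𝒰 : Finset (Finset V)) (ha : ∀ U ∈ 𝒰, a ≤ #U) :
    (SimpleGraph.binomialRandom V p).real {G | ∃ U ∈ 𝒰, ∃ D : Fin T → Fin H → V,
      (∀ i j, i ≠ j → Disjoint (univ.image (D i)) (univ.image (D j))) ∧
        ∀ u ∈ U, ∀ j, ∃ d ∈ univ.image (D j), G.Adj u d} ≤
      #𝒰 * (Fintype.card V : ℝ) ^ (H * T) * (1 - (1 - (p : ℝ)) ^ H) ^ (T * (a - T * H)) := by
  classical
  have hp0 : (0 : ℝ) ≤ 1 - p := sub_nonneg.2 p.2.2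
  have hp1 : 1 - (p : ℝ) ≤ 1 := sub_le_self _ p.2.1
  have hρ0 : (0 : ℝ) ≤ 1 - (1 - (p : ℝ)) ^ H := sub_nonneg.2 (pow_le_one₀ hp0 hp1)
  have hρ1 : 1 - (1 - (p : ℝ)) ^ H ≤ 1 := sub_le_self _ (pow_nonneg hp0 _)
  set A : Finset V × (Fin T → Fin H → V) → Set (SimpleGraph V) := fun x =>
    {G | (∀ i j, i ≠ j → Disjoint (univ.image (x.2 i)) (univ.image (x.2 j))) ∧
      ∀ u ∈ x.1, ∀ j, ∃ d ∈ univ.image (x.2 j), G.Adj u d} with hA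
  have hbound : ∀ x ∈ 𝒰 ×ˢ (univ : Finset (Fin T → Fin H → V)),
      (SimpleGraph.binomialRandom V p).real (A x) ≤
        (1 - (1 - (p : ℝ)) ^ H) ^ (T * (a - T * H)) := by
    rintro ⟨U, D⟩ hx
    by_cases hD : ∀ i j, i ≠ j → Disjoint (univ.image (D i)) (univ.image (D j))
    · refine (measureReal_mono fun G hG => hG.2).trans
        ((binomialRandom_forall_exists_adj_le p U (fun j => univ.image (D j)) hD (H := H)
          fun j => card_image_le.trans (by simp)).trans ?_)
      refine pow_le_pow_of_le_one hρ0 hρ1 (Nat.mul_le_mul_left _ ?_)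
      exact Nat.sub_le_sub_right (ha U (mem_product.1 hx).1) _
    · have : A (U, D) = ∅ := Set.eq_empty_of_forall_notMem fun G hG => hD hG.1
      rw [this, measureReal_empty]
      positivity
  calc _ ≤ (SimpleGraph.binomialRandom V p).real
        (⋃ x ∈ 𝒰 ×ˢ (univ : Finset (Fin T → Fin H → V)), A x) := by
        refine measureReal_mono ?_ (measure_ne_top _ _)
        rintro G ⟨U, hU, D, hD⟩
        simp only [Set.mem_iUnion]
        exact ⟨(U, D), mem_product.2 ⟨hU, mem_univ D⟩, hD⟩
    _ ≤ ∑ x ∈ 𝒰 ×ˢ (univ : Finset (Fin T → Fin H → V)),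
          (SimpleGraph.binomialRandom V p).real (A x) := measureReal_biUnion_finset_le _ _
    _ ≤ #(𝒰 ×ˢ (univ : Finset (Fin T → Fin H → V))) •
          (1 - (1 - (p : ℝ)) ^ H) ^ (T * (a - T * H)) := sum_le_card_nsmul _ _ _ hbound
    _ = _ := by
        rw [nsmul_eq_mul, card_product, card_univ, Fintype.card_fun, Fintype.card_fun,
          Fintype.card_fin, Fintype.card_fin, ← pow_mul]
        push_cast; ring

end RandomGraph

open Filter Topology

/-! ### Expansion of the random graph -/

section Expansion

variable {V : Type*} [Fintype V] [DecidableEq V] {G : SimpleGraph V}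

lemma exists_image_eq {D : Finset V} {H : ℕ} (hD : D.Nonempty) (hH : #D ≤ H) :
    ∃ g : Fin H → V, univ.image g = D := by
  obtain ⟨e⟩ : Nonempty (D ↪ Fin H) :=
    Function.Embedding.nonempty_of_card_le (by simpa using hH)
  have : Nonempty D := hD.to_subtype
  refine ⟨fun i => (Function.invFun e i : D), ?_⟩
  ext v
  simp only [mem_image, mem_univ, true_and]
  constructor
  · rintro ⟨i, rfl⟩; exact (Function.invFun e i).2
  · exact fun hv => ⟨e ⟨v, hv⟩, by rw [Function.leftInverse_invFun e.injective]⟩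

/-- A bad family of `T` sets dominates all but at most `T * t` vertices of `U`. -/
lemma IsBadFamily.exists_dominated {H t T : ℕ} {U : Finset V} {F : Finset (Finset V)}
    (hF : IsBadFamily G H t U F) (hT : T ≤ #F) :
    ∃ U' : Finset V, #U - T * t ≤ #U' ∧ ∃ D : Fin T → Fin H → V,
      (∀ i j, i ≠ j → Disjoint (univ.image (D i)) (univ.image (D j))) ∧
        ∀ u ∈ U', ∀ j, ∃ d ∈ univ.image (D j), G.Adj u d := by
  obtain ⟨e⟩ : Nonempty (Fin T ↪ F) := Function.Embedding.nonempty_of_card_le (by simpa using hT)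
  choose D hD using fun j => exists_image_eq (hF.nonempty _ (e j).2) (hF.card_le _ (e j).2)
  refine ⟨U \ univ.biUnion fun j => nonNeighbours G U (e j), ?_, D, fun i j hij => ?_,
    fun u hu j => ?_⟩
  · have h1 : #(univ.biUnion fun j => nonNeighbours G U (e j)) ≤ T * t := by
      simpa using card_biUnion_le_card_mul univ (fun j => nonNeighbours G U (e j)) t
        fun j _ => (hF.bad _ (e j).2).le
    have h2 := le_card_sdiff (univ.biUnion fun j => nonNeighbours G U (e j)) U
    omega
  · rw [hD, hD]
    exact hF.disjoint (e i).2 (e j).2 fun h => hij (e.injective (Subtype.ext h))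
  · by_contra! hno
    rw [hD] at hno
    exact (mem_sdiff.1 hu).2
      (mem_biUnion.2 ⟨j, mem_univ j, mem_nonNeighbours.2 ⟨(mem_sdiff.1 hu).1, hno⟩⟩)

/-- A large set `U` rarely has a large bad family: the union bound over the `2 ^ n` sets `U` is
affordable because a bad family forces independent events for linearly many vertices. -/
lemma binomialRandom_not_expands_le (p : unitInterval) (s t H T : ℕ) :
    (SimpleGraph.binomialRandom V p).real {G | ¬ ∀ U : Finset V, s ≤ #U →
      ∀ F, IsBadFamily G H t U F → #F ≤ T} ≤
      2 ^ Fintype.card V * (Fintype.card V : ℝ) ^ (H * T) *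
        (1 - (1 - (p : ℝ)) ^ H) ^ (T * (s - T * t - T * H)) := by
  classical
  have hρ0 : (0 : ℝ) ≤ 1 - (1 - (p : ℝ)) ^ H :=
    sub_nonneg.2 (pow_le_one₀ (sub_nonneg.2 p.2.2) (sub_le_self _ p.2.1))
  refine (measureReal_mono ?_).trans <|
    (binomialRandom_exists_dominating_le p (T := T) (H := H) (a := s - T * t)
      {U : Finset V | s - T * t ≤ #U} (by simp)).trans ?_
  · intro G hG
    simp only [Set.mem_ofPred_eq] at hG
    push Not at hG
    obtain ⟨U, hU, F, hF, hT⟩ := hG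
    obtain ⟨U', hU', h⟩ := hF.exists_dominated hT.le
    exact ⟨U', mem_filter.2 ⟨mem_univ _, by omega⟩, h⟩
  · gcongr
    calc (#({U : Finset V | s - T * t ≤ #U} : Finset (Finset V)) : ℝ)
        ≤ (#(univ : Finset (Finset V)) : ℝ) := by exact_mod_cast card_filter_le _ _
      _ = 2 ^ Fintype.card V := by simp

/-- In each `X i`, a fixed number `t` of vertices survives every set of at most `H` vertices. -/
lemma binomialRandom_not_start_le {ι : Type*} [Fintype ι] (p : unitInterval) {X : ι → Finset V}
    {a t H : ℕ} (ha : ∀ i, a ≤ #(X i)) (hta : t ≤ a) :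
    (SimpleGraph.binomialRandom V p).real {G | ¬ ∀ i, ∀ D : Finset V, #D ≤ H →
      t ≤ #(nonNeighbours G (X i) D)} ≤
      (Fintype.card ι * (Fintype.card V : ℝ) ^ t) * (Fintype.card V : ℝ) ^ H *
        (1 - (1 - (p : ℝ)) ^ H) ^ (a - t - H) := by
  classical
  have hρ0 : (0 : ℝ) ≤ 1 - (1 - (p : ℝ)) ^ H :=
    sub_nonneg.2 (pow_le_one₀ (sub_nonneg.2 p.2.2) (sub_le_self _ p.2.1))
  set 𝒰 : Finset (Finset V) := (univ ×ˢ powersetCard t univ).image fun x : ι × Finset V =>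
    X x.1 \ x.2 with h𝒰
  have hcard : ∀ U ∈ 𝒰, a - t ≤ #U := by
    intro U hU
    obtain ⟨⟨i, S⟩, hx, rfl⟩ := mem_image.1 hU
    have h1 := le_card_sdiff S (X i)
    have h2 := (mem_powersetCard.1 (mem_product.1 hx).2).2
    have h3 := ha i
    simp only at h2 ⊢
    omega
  refine (measureReal_mono ?_).trans <|
    (binomialRandom_exists_dominating_le p (T := 1) (H := H) 𝒰 hcard).trans ?_
  · intro G hG
    simp only [Set.mem_ofPred_eq] at hG
    push Not at hG
    obtain ⟨i, D, hD, hlt⟩ := hG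
    have hne : D.Nonempty := by
      by_contra h
      rw [not_nonempty_iff_eq_empty.1 h, nonNeighbours_empty] at hlt
      have := ha i
      omega
    obtain ⟨S, hS, hSt⟩ := exists_superset_card_eq hlt.le
      ((hta.trans (ha i)).trans (card_le_univ _))
    obtain ⟨g, hg⟩ := exists_image_eq hne hD
    refine ⟨X i \ S, mem_image.2 ⟨(i, S), mem_product.2 ⟨mem_univ i, mem_powersetCard.2
      ⟨subset_univ S, hSt⟩⟩, rfl⟩, fun _ => g, fun j k hjk => absurd (Subsingleton.elim j k) hjk,
      fun u hu _ => ?_⟩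
    by_contra! hno
    rw [hg] at hno
    exact (mem_sdiff.1 hu).2 (hS (mem_nonNeighbours.2 ⟨(mem_sdiff.1 hu).1, hno⟩))
  · rw [mul_one, one_mul, one_mul]
    gcongr
    calc (#𝒰 : ℝ) ≤ (Fintype.card ι * (Fintype.card V).choose t : ℕ) := by
          refine Nat.cast_le.2 (card_image_le.trans ?_)
          rw [card_product, card_powersetCard, card_univ, card_univ]
      _ ≤ Fintype.card ι * (Fintype.card V : ℝ) ^ t := by
          push_cast
          gcongr
          exact_mod_cast Nat.choose_le_pow _ _

end Expansion

/-! ### Asymptotics -/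

/-- The failure probability of the expansion property tends to zero if the width `T` is large
enough for the expansion to beat the `2 ^ n` sets. -/
lemma eventually_expands_bound {ρ κ δ : ℝ} (hρ0 : 0 ≤ ρ) (hρ1 : ρ < 1) (hκ : 0 < κ) (hδ : 0 < δ)
    (H : ℕ) : ∃ T : ℕ, 0 < T ∧ ∀ᶠ n : ℕ in atTop,
      2 ^ n * (n : ℝ) ^ (H * T) *
        ρ ^ (T * (⌈κ * n⌉₊ - T * ⌊κ * n / (2 * T)⌋₊ - T * H)) ≤ δ := by
  obtain ⟨A, hA⟩ := exists_nat_ge (4 / κ)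
  obtain ⟨T, hT⟩ := exists_pow_lt_of_lt_one (show (0 : ℝ) < (1 / 4) ^ A by positivity) hρ1
  refine ⟨T + 1, T.succ_pos, ?_⟩
  have hT' : ρ ^ (T + 1) ≤ (1 / 4) ^ A :=
    (pow_le_pow_of_le_one hρ0 hρ1.le (Nat.le_succ T)).trans hT.le
  generalize hT₁ : T + 1 = T₁ at hT' ⊢
  have hT₁pos : (0 : ℝ) < T₁ := by rw [← hT₁]; positivity
  have hlim : Tendsto (fun n : ℕ => (n : ℝ) ^ (H * T₁) * (1 / 2 : ℝ) ^ n) atTop (𝓝 0) :=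
    tendsto_pow_const_mul_const_pow_of_abs_lt_one _ (by norm_num [abs_of_pos])
  filter_upwards [hlim.eventually_le_const hδ, eventually_ge_atTop ⌈4 * (T₁ * H) / κ⌉₊]
    with n hn hnN
  refine le_trans ?_ hn
  have hbig : 4 * (T₁ * H) ≤ κ * n := by
    have := Nat.ceil_le.1 hnN
    rwa [div_le_iff₀ hκ, mul_comm (n : ℝ)] at this
  have hexp : n ≤ A * (⌈κ * n⌉₊ - T₁ * ⌊κ * n / (2 * T₁)⌋₊ - T₁ * H) := by
    have h1 : κ * n ≤ ⌈κ * n⌉₊ := Nat.le_ceil _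
    have h2 : (T₁ : ℝ) * ⌊κ * n / (2 * T₁)⌋₊ ≤ κ * n / 2 := by
      calc (T₁ : ℝ) * ⌊κ * n / (2 * T₁)⌋₊ ≤ T₁ * (κ * n / (2 * T₁)) := by
            gcongr; exact Nat.floor_le (by positivity)
        _ = κ * n / 2 := by field_simp
    have h3 : (⌈κ * n⌉₊ : ℝ) ≤ ((⌈κ * n⌉₊ - T₁ * ⌊κ * n / (2 * T₁)⌋₊ - T₁ * H : ℕ) : ℝ) +
        T₁ * ⌊κ * n / (2 * T₁)⌋₊ + T₁ * H := by
      have : ⌈κ * n⌉₊ ≤ (⌈κ * n⌉₊ - T₁ * ⌊κ * n / (2 * T₁)⌋₊ - T₁ * H) +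
        T₁ * ⌊κ * n / (2 * T₁)⌋₊ + T₁ * H := by omega
      exact_mod_cast this
    set k := ⌈κ * n⌉₊ - T₁ * ⌊κ * n / (2 * T₁)⌋₊ - T₁ * H
    have h4 : κ / 4 * n ≤ k := by linarith
    have h5 : (1 : ℝ) ≤ A * (κ / 4) := by
      rw [div_le_iff₀ hκ] at hA; linarith
    have : (n : ℝ) ≤ A * k := by
      calc (n : ℝ) ≤ A * (κ / 4) * n := le_mul_of_one_le_left (Nat.cast_nonneg n) h5
        _ = A * (κ / 4 * n) := by ring
        _ ≤ A * k := by gcongr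
    exact_mod_cast this
  set k := ⌈κ * n⌉₊ - T₁ * ⌊κ * n / (2 * T₁)⌋₊ - T₁ * H
  have hpow : ρ ^ (T₁ * k) ≤ (1 / 4) ^ n := by
    calc ρ ^ (T₁ * k) = (ρ ^ T₁) ^ k := pow_mul _ _ _
      _ ≤ ((1 / 4) ^ A) ^ k := by gcongr
      _ = (1 / 4) ^ (A * k) := (pow_mul _ _ _).symm
      _ ≤ (1 / 4) ^ n := pow_le_pow_of_le_one (by norm_num) (by norm_num) hexp
  calc (2 : ℝ) ^ n * (n : ℝ) ^ (H * T₁) * ρ ^ (T₁ * k)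
      ≤ 2 ^ n * (n : ℝ) ^ (H * T₁) * (1 / 4) ^ n := by gcongr
    _ = (n : ℝ) ^ (H * T₁) * (2 * (1 / 4)) ^ n := by rw [mul_pow]; ring
    _ = (n : ℝ) ^ (H * T₁) * (1 / 2) ^ n := by norm_num

/-- The failure probability of the property needed at the start of the game tends to zero. -/
lemma eventually_start_bound {ρ γ δ : ℝ} (hρ0 : 0 ≤ ρ) (hρ1 : ρ < 1) (hγ : 0 < γ) (hδ : 0 < δ)
    (l t H : ℕ) : ∀ᶠ n : ℕ in atTop,
      (l * (n : ℝ) ^ t) * (n : ℝ) ^ H * ρ ^ (⌈γ * n⌉₊ - t - H) ≤ δ := by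
  obtain ⟨A, hA⟩ := exists_nat_ge (2 / γ)
  have hlarge : ∀ᶠ n : ℕ in atTop, n ≤ A * (⌈γ * n⌉₊ - t - H) := by
    filter_upwards [eventually_ge_atTop ⌈2 * ((t : ℝ) + H) / γ⌉₊] with n hn
    have hbig : 2 * ((t : ℝ) + H) ≤ γ * n := by
      have := Nat.ceil_le.1 hn
      rwa [div_le_iff₀ hγ, mul_comm (n : ℝ)] at this
    have h1 : γ * n ≤ ⌈γ * n⌉₊ := Nat.le_ceil _
    have h3 : (⌈γ * n⌉₊ : ℝ) ≤ ((⌈γ * n⌉₊ - t - H : ℕ) : ℝ) + t + H := by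
      have : ⌈γ * n⌉₊ ≤ (⌈γ * n⌉₊ - t - H) + t + H := by omega
      exact_mod_cast this
    have h4 : γ / 2 * n ≤ ((⌈γ * n⌉₊ - t - H : ℕ) : ℝ) := by linarith
    have h5 : (1 : ℝ) ≤ A * (γ / 2) := by
      rw [div_le_iff₀ hγ] at hA; linarith
    have : (n : ℝ) ≤ A * ((⌈γ * n⌉₊ - t - H : ℕ) : ℝ) := by
      calc (n : ℝ) ≤ A * (γ / 2) * n := le_mul_of_one_le_left (Nat.cast_nonneg n) h5
        _ = A * (γ / 2 * n) := by ring
        _ ≤ _ := by gcongr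
    exact_mod_cast this
  have hk : Tendsto (fun n : ℕ => ⌈γ * n⌉₊ - t - H) atTop atTop := by
    refine tendsto_atTop.2 fun b => ?_
    filter_upwards [hlarge, eventually_gt_atTop (A * b)] with n hn hnb
    exact (lt_of_mul_lt_mul_left (hnb.trans_le hn) (Nat.zero_le A)).le
  have hlim : Tendsto (fun k : ℕ => (l * (A : ℝ) ^ (t + H)) * ((k : ℝ) ^ (t + H) * ρ ^ k))
      atTop (𝓝 0) := by
    simpa using (tendsto_pow_const_mul_const_pow_of_abs_lt_one (t + H)
      (by rwa [abs_of_nonneg hρ0])).const_mul (l * (A : ℝ) ^ (t + H))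
  filter_upwards [(hlim.comp hk).eventually_le_const hδ, hlarge] with n hn hnA
  refine le_trans ?_ hn
  have hnA' : (n : ℝ) ≤ A * (⌈γ * n⌉₊ - t - H : ℕ) := by exact_mod_cast hnA
  simp only [Function.comp]
  calc (l * (n : ℝ) ^ t) * (n : ℝ) ^ H * ρ ^ (⌈γ * n⌉₊ - t - H)
      = l * (n : ℝ) ^ (t + H) * ρ ^ (⌈γ * n⌉₊ - t - H) := by rw [pow_add]; ring
    _ ≤ l * (A * (⌈γ * n⌉₊ - t - H : ℕ)) ^ (t + H) * ρ ^ (⌈γ * n⌉₊ - t - H) := by gcongr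
    _ = _ := by rw [mul_pow]; ring

/-! ### Bob's win on the random graph -/

/-- The two expansion properties of the random graph guarantee that Bob wins. -/
lemma one_sub_le_bobCanFill {V C ι : Type*} [DecidableEq V] [DecidableEq C] [Fintype V] [Fintype C]
    [Fintype ι] {X : ι → Finset V} {Y : ι → Finset C} {P : Parameters} {q h : ℕ} {δ : ℝ}
    (p : unitInterval) (hX : ∀ i j, i ≠ j → Disjoint (X i) (X j))
    (hP : ∀ G : SimpleGraph V, (∀ U : Finset V, P.large ≤ #U →
      ∀ F, IsBadFamily G P.height P.scarce U F → #F ≤ P.width) →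
      P.Suitable G (Fintype.card ι) q h)
    (hspace : ∀ i, P.large + P.slack + 2 * #(Y i) ≤ #(X i))
    (hexp : (SimpleGraph.binomialRandom V p).real {G | ¬ ∀ U : Finset V, P.large ≤ #U →
      ∀ F, IsBadFamily G P.height P.scarce U F → #F ≤ P.width} ≤ δ / 2)
    (hstart : (SimpleGraph.binomialRandom V p).real {G | ¬ ∀ i, ∀ D : Finset V, #D ≤ P.height →
      P.reserve ≤ #(nonNeighbours G (X i) D)} ≤ δ / 2) :
    1 - δ ≤ (SimpleGraph.binomialRandom V p).real {G | BobCanFill G X Y} := by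
  set A := {G : SimpleGraph V | ¬ ∀ U : Finset V, P.large ≤ #U →
      ∀ F, IsBadFamily G P.height P.scarce U F → #F ≤ P.width}
  set B := {G : SimpleGraph V | ¬ ∀ i, ∀ D : Finset V, #D ≤ P.height →
      P.reserve ≤ #(nonNeighbours G (X i) D)}
  set W := {G : SimpleGraph V | BobCanFill G X Y}
  have hcover : (Set.univ : Set (SimpleGraph V)) ⊆ W ∪ (A ∪ B) := by
    intro G _
    by_contra hG
    rw [Set.mem_union, Set.mem_union, not_or, not_or] at hG
    exact hG.1 (bobCanFill_of_suitable hX (hP G (not_not.1 hG.2.1)) (not_not.1 hG.2.2) hspace)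
  have h1 := measureReal_mono (μ := SimpleGraph.binomialRandom V p) hcover
  have h2 := measureReal_union_le (μ := SimpleGraph.binomialRandom V p) W (A ∪ B)
  have h3 := measureReal_union_le (μ := SimpleGraph.binomialRandom V p) A B
  rw [probReal_univ] at h1
  linarith

end ColouringGame

open ColouringGame Finset Filter in
theorem mainTheorem3 (ε η γ : ℝ) (hε : 0 < ε) (hη : 0 < η) (hγ : 0 < γ) (l : ℕ)
    (p : ℝ) (hp : p ∈ Set.Ioo (0 : ℝ) 1) :
    ∀ δ : ℝ, 0 < δ → ∃ N : ℕ, ∀ n : ℕ, N ≤ n →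
      ∀ (X : Fin l → Finset (Fin n)) (Y : Fin l → Finset (Fin ⌊(p / 2 - ε) * (n : ℝ)⌋₊)),
        (∀ i j, i ≠ j → Disjoint (X i) (X j)) →
        (∀ i, γ * (n : ℝ) ≤ ((X i).card : ℝ)) →
        (∀ i, ((Y i).card : ℝ) ≤ (1 - η) * ((X i).card : ℝ) / 2) →
        1 - δ ≤ (SimpleGraph.binomialRandom (Fin n) ⟨p, hp.1.le, hp.2.le⟩).real
          {G | ColouringGame.BobCanFill G X Y} := by
  intro δ hδ
  -- The slack `η * γ * n = 4 * κ * n` is divided between the `κ * n` uncoloured vertices that are to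
  -- remain, the at most `κ * n / 2` answers in heavy colours, each of which costs two, and the
  -- boundedly many other special moves. There are at most `n / m` heavy colours, each of which is
  -- answered at most `l` times, and this is at most `κ * n / 2` if `m ≥ 2 * l / κ`.
  obtain ⟨κ, hκ⟩ : ∃ κ, κ = η * γ / 4 := ⟨_, rfl⟩
  have hκ0 : 0 < κ := by rw [hκ]; positivity
  obtain ⟨m, hm⟩ := exists_nat_ge (2 * (l : ℝ) / κ + 1)
  have hm0 : 0 < m := by
    have : (0 : ℝ) < m := lt_of_lt_of_le (by positivity) hm
    exact_mod_cast this
  have hml : 2 * (l : ℝ) ≤ m * κ := by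
    have : 2 * (l : ℝ) / κ ≤ m := by linarith
    rwa [div_le_iff₀ hκ0] at this
  obtain ⟨H, hH⟩ : ∃ H, H = m + 2 * l + 1 := ⟨_, rfl⟩
  have hp1 : 0 < 1 - p := sub_pos.2 hp.2
  have hρ0 : 0 ≤ 1 - (1 - p) ^ H := sub_nonneg.2 (pow_le_one₀ hp1.le (sub_le_self _ hp.1.le))
  have hρ1 : 1 - (1 - p) ^ H < 1 := sub_lt_self _ (pow_pos hp1 _)
  obtain ⟨T, hT, hexp⟩ := eventually_expands_bound hρ0 hρ1 hκ0 (half_pos hδ) H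
  obtain ⟨q, hq⟩ : ∃ q, q = (l + 1) ^ 2 * (l * (T * H)) := ⟨_, rfl⟩
  have hstart := eventually_start_bound hρ0 hρ1 hγ (half_pos hδ) l (2 * q + 3) H
  have hcast : Tendsto (fun n : ℕ => (n : ℝ)) atTop atTop := tendsto_natCast_atTop_atTop
  have hlarge : ∀ᶠ n : ℕ in atTop, 2 * q + 3 ≤ ⌊κ * n / (2 * T)⌋₊ ∧ 2 * q + 3 ≤ ⌈γ * n⌉₊ ∧
      2 * (q : ℝ) + 3 ≤ 2 * κ * n := by
    refine .and ?_ (.and ?_ ?_)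
    · refine Tendsto.eventually_ge_atTop ?_ _
      exact tendsto_nat_floor_atTop.comp
        ((hcast.const_mul_atTop hκ0).atTop_div_const (by positivity))
    · refine Tendsto.eventually_ge_atTop ?_ _
      exact tendsto_nat_ceil_atTop.comp (hcast.const_mul_atTop hγ)
    · exact (hcast.const_mul_atTop (by positivity)).eventually_ge_atTop _
  obtain ⟨N, hN⟩ := eventually_atTop.1 (hexp.and (hstart.and hlarge))
  refine ⟨N, fun n hn X Y hX hXc hYc => ?_⟩
  obtain ⟨hexp, hstart, hfloor, hceil, hn2⟩ := hN n hn
  have hXc' : ∀ i, ⌈γ * n⌉₊ ≤ #(X i) := fun i => Nat.ceil_le.2 (hXc i)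
  obtain ⟨h, hh⟩ : ∃ h, h = ⌈κ * n / 2⌉₊ := ⟨_, rfl⟩
  refine one_sub_le_bobCanFill (P := ⟨m, H, T, ⌈κ * n⌉₊, ⌊κ * n / (2 * T)⌋₊, 2 * q + 3,
    2 * (q + h)⟩) (q := q) (h := h) _ hX (fun G hG => ?_) (fun i => ?_) ?_ ?_
  · refine ⟨hG, hm0, ?_, ?_, hfloor, ?_, ?_, ?_, rfl⟩
    · simpa using hH
    · refine Nat.floor_le_of_le (le_trans ?_ (Nat.le_ceil _))
      refine div_le_self (by positivity) ?_
      have : (1 : ℝ) ≤ T := by exact_mod_cast hT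
      linarith
    · simpa using hq.ge
    · exact Nat.lt_succ_self _
    · have h1 : (l : ℝ) * n ≤ m * h := by
        have h2 : κ * n / 2 ≤ h := by rw [hh]; exact Nat.le_ceil _
        have h3 : 2 * (l : ℝ) * n ≤ m * κ * n := by gcongr
        have h4 : (m : ℝ) * (κ * n / 2) ≤ m * h := by gcongr
        linarith
      simpa using (by exact_mod_cast h1 : l * n ≤ m * h)
  · have h1 : (⌈κ * n⌉₊ : ℝ) < κ * n + 1 := Nat.ceil_lt_add_one (by positivity)
    have h2 : (h : ℝ) < κ * n / 2 + 1 := by rw [hh]; exact Nat.ceil_lt_add_one (by positivity)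
    have h3 : 4 * κ * n ≤ η * #(X i) := by
      calc 4 * κ * n = η * (γ * n) := by rw [hκ]; ring
        _ ≤ η * #(X i) := by gcongr; exact hXc i
    have h4 := hYc i
    have : (⌈κ * n⌉₊ : ℝ) + 2 * (q + h) + 2 * #(Y i) ≤ #(X i) := by linarith
    exact_mod_cast this
  · refine (binomialRandom_not_expands_le _ _ _ _ _).trans ?_
    simpa using hexp
  · refine (binomialRandom_not_start_le _ hXc' hceil).trans ?_
    simpa using hstart
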